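/- **Conventions.** All vector spaces are complex and finite-dimensional; inner products are antilinear in the first variable. An *$H^*$-category* is a category enriched in finite-dimensional Hilbert spaces and linear maps, with antilinear maps $*\colon \mathrm{Hom}(x,y)\to\mathrm{Hom}(y,x)$ such that $f^{**}=f$, $(fg)^*=g^*f^*$, $(fg,h)=(g,f^*h)$ and $(fg,h)=(f,hg^*)$. A *2-Hilbert space* is a Cauchy complete $H^*$-category, i.e. one in which all finite direct sums (including a zero object) exist and all idempotents split. An object $e$ is *simple* if $\mathrm{Hom}(e,e)\cong\mathbb{C}$. A 2-Hilbert space is *finite-dimensional* if it has finitely many isomorphism classes of simple objects, and *marked* if each such class has a distinguished representative $e_i$; the *scale factor* of $e_i$ is $k_i=(\mathrm{id}_{e_i},\mathrm{id}_{e_i})>0$. Let $2\mathcal{H}\mathrm{ilb}_m$ be the 2-category of finite-dimensional marked 2-Hilbert spaces, linear $*$-functors ($F(f^*)=F(f)^*$, no condition on the markings) and natural transformations. For $\theta,\theta'\colon F\Rightarrow G$, with $F,G\colon H\to H'$, put $(\theta,\theta')=\sum_i k_i(\theta_{e_i},\theta'_{e_i})$, the sum being over the marked simple objects of $H$. Let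 $\mathcal{F}\mathrm{inSpaces}$ be the following (weak) 2-category. An object is a finite set $X$ with a positive real number $k_x$ for each $x\in X$. A morphism $E\colon X\to Y$ is a family of finite-dimensional Hilbert spaces $\langle y|E|x\rangle$, $(y,x)\in Y\times X$. A 2-morphism $f\colon E\Rightarrow F$ is a family of linear maps $f_{y,x}\colon\langle y|E|x\rangle\to\langle y|F|x\rangle$. Composition of morphisms is $$\langle z|F\circ E|x\rangle=\bigoplus_{y\in Y}\tfrac1{k_y}\,\langle z|F|y\rangle\otimes\langle y|E|x\rangle ,$$ where $\frac1{k_y}$ means that the inner product on the $y$-th summand is $(v_1\otimes w_1,v_2\otimes w_2)=\frac1{k_y}(v_1,v_2)(w_1,w_2)$. The identity morphism is $\langle y|\mathrm{id}|x\rangle=\delta_{x,y}k_x\mathbb{C}$ (so $(1,1)=k_x$ when $y=x$). The associators are the ordinary fibrewise associators of tensor products, and the unit constraints are $v\otimes 1\mapsto v$ and $1\otimes v\mapsto v$. For $f,g\colon E\Rightarrow F$ put $(f,g)=\sum_{x,y}k_xk_y\,\mathrm{Tr}(f_{y,x}^*\,g_{y,x})$. A 2-morphism is *unitary* if each $f_{y,x}$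 is unitary. Define $\langle\cdot\rangle\colon 2\mathcal{H}\mathrm{ilb}_m\to\mathcal{F}\mathrm{inSpaces}$ by sending $H$ to its set $\langle H\rangle$ of marked simple objects with their scale factors, a linear $*$-functor $F\colon H\to H'$ to the bundle $\langle\mu|F|i\rangle=\mathrm{Hom}(e_\mu,Fe_i)$, and $\theta\colon F\Rightarrow G$ to the map of bundles $\langle\theta\rangle_{\mu,i}$ given by postcomposition with $\theta_{e_i}$. Its coherence 2-cells are the compositors $\langle G\rangle\circ\langle F\rangle\to\langle GF\rangle$, $g\otimes f\mapsto G(f)\circ g$ for $g\in\langle\lambda|G|\mu\rangle$ and $f\in\langle\mu|F|i\rangle$, and the unit maps $\mathrm{id}_{\langle H\rangle}\to\langle\mathrm{id}_H\rangle$, $1\mapsto\mathrm{id}_{e_i}$ (fibrewise, and $0$ off the diagonal). **Proposition.** 1. With these coherence 2-cells $\langle\cdot\rangle$ is a weak 2-functor; in particular the coherence 2-cells are invertible and satisfy the coherence laws. Moreover they are unitary. 2. $\langle\cdot\rangle$ is an equivalence of 2-categories: for all $H,H'$ the functor $\mathrm{Hom}(H,H')\to\mathrm{Hom}(\langle H\rangle,\langle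 H'\rangle)$ is an equivalence of categories, and every finite space is equivalent in $\mathcal{F}\mathrm{inSpaces}$ to some $\langle H\rangle$. 3. For all $F,G\colon H\to H'$ the map $\theta\mapsto\langle\theta\rangle$ from natural transformations $F\Rightarrow G$ to 2-morphisms $\langle F\rangle\Rightarrow\langle G\rangle$ is a unitary linear map, i.e. a linear bijection with $(\langle\theta\rangle,\langle\theta'\rangle)=(\theta,\theta')$. -/

import Mathlib

open CategoryTheory CategoryTheory.Limits CategoryTheory.Bicategory
open scoped TensorProduct

universe w w' v v' u u' u''

noncomputable section

/-! ## `H^*`-categories and 2-Hilbert spaces -/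

/-- An `H^*`-category: a category enriched over finite-dimensional complex Hilbert spaces and
linear maps, with antilinear maps `dag : Hom(x, y) → Hom(y, x)` satisfying `f^{**} = f`,
`(fg)^* = g^* f^*`, `(fg, h) = (g, f^* h)` and `(fg, h) = (f, h g^*)`.  The inner products are
antilinear in the first variable, and `g ≫ f` is the composite `fg` (first `g`, then `f`). -/
class HStarCategory (H : Type u) [Category.{v} H] where
  normedAddCommGroup (x y : H) : NormedAddCommGroup (x ⟶ y)
  innerProductSpace (x y : H) : InnerProductSpace ℂ (x ⟶ y)
  finiteDimensional (x y : H) : FiniteDimensional ℂ (x ⟶ y)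
  add_comp {x y z : H} (g g' : x ⟶ y) (f : y ⟶ z) : (g + g') ≫ f = g ≫ f + g' ≫ f
  comp_add {x y z : H} (g : x ⟶ y) (f f' : y ⟶ z) : g ≫ (f + f') = g ≫ f + g ≫ f'
  smul_comp {x y z : H} (a : ℂ) (g : x ⟶ y) (f : y ⟶ z) : (a • g) ≫ f = a • (g ≫ f)
  comp_smul {x y z : H} (g : x ⟶ y) (a : ℂ) (f : y ⟶ z) : g ≫ (a • f) = a • (g ≫ f)
  dag {x y : H} (f : x ⟶ y) : y ⟶ x
  dag_add {x y : H} (f g : x ⟶ y) : dag (f + g) = dag f + dag g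
  dag_smul {x y : H} (a : ℂ) (f : x ⟶ y) : dag (a • f) = (starRingEnd ℂ a) • dag f
  dag_dag {x y : H} (f : x ⟶ y) : dag (dag f) = f
  dag_comp {x y z : H} (g : x ⟶ y) (f : y ⟶ z) : dag (g ≫ f) = dag f ≫ dag g
  inner_comp_left {x y z : H} (g : x ⟶ y) (f : y ⟶ z) (h : x ⟶ z) :
    inner ℂ (g ≫ f) h = inner ℂ g (h ≫ dag f)
  inner_comp_right {x y z : H} (g : x ⟶ y) (f : y ⟶ z) (h : x ⟶ z) :
    inner ℂ (g ≫ f) h = inner ℂ f (dag g ≫ h)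

namespace HStarCategory

attribute [reducible, instance] normedAddCommGroup innerProductSpace
attribute [instance] finiteDimensional

instance instPreadditive (H : Type u) [Category.{v} H] [HStarCategory H] : Preadditive H where
  homGroup x y := (normedAddCommGroup x y).toAddCommGroup
  add_comp _ _ _ g g' f := HStarCategory.add_comp g g' f
  comp_add _ _ _ g f f' := HStarCategory.comp_add g f f'

instance instLinear (H : Type u) [Category.{v} H] [HStarCategory H] : Linear ℂ H where
  homModule x y := (innerProductSpace x y).toModule
  smul_comp _ _ _ a g f := HStarCategory.smul_comp a g f
  comp_smul _ _ _ g a f := HStarCategory.comp_smul g a f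

end HStarCategory

/-- A Cauchy complete `H^*`-category, i.e. a 2-Hilbert space: all finite direct sums exist
(including the empty one, the zero object), and all idempotents split. -/
class IsTwoHilbert (H : Type u) [Category.{v} H] [HStarCategory H] : Prop where
  hasFiniteBiproducts : HasFiniteBiproducts H
  isIdempotentComplete : IsIdempotentComplete H

/-- An object `e` is simple if `Hom(e, e) ≅ ℂ`. -/
def IsSimpleObject {H : Type u} [Category.{v} H] [HStarCategory H] (e : H) : Prop :=
  Module.finrank ℂ (e ⟶ e) = 1

set_option linter.checkUnivs false in
/-- A finite-dimensional marked 2-Hilbert space: a 2-Hilbert space with finitely many isomorphism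
classes of simple objects, each endowed with a distinguished representative.  The marked simple
objects are the `e i`, for `i` in the finite set `ι`. -/
structure MarkedTwoHilb where
  carrier : Type u
  [category : Category.{v} carrier]
  [hStar : HStarCategory carrier]
  [isTwoHilbert : IsTwoHilbert carrier]
  ι : Type v
  [fintype : Fintype ι]
  e : ι → carrier
  isSimple (i : ι) : IsSimpleObject (e i)
  existsUnique_iso (x : carrier) (hx : IsSimpleObject x) : ∃! i, Nonempty (x ≅ e i)

attribute [instance] MarkedTwoHilb.category MarkedTwoHilb.hStar MarkedTwoHilb.isTwoHilbert
  MarkedTwoHilb.fintype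

/-- The scale factor `k_i = (id, id)` of the marked simple object `e i`. -/
def MarkedTwoHilb.scale (H : MarkedTwoHilb.{v, u}) (i : H.ι) : {r : ℝ // 0 < r} :=
  ⟨RCLike.re (inner ℂ (𝟙 (H.e i)) (𝟙 (H.e i))), by
    have h : (𝟙 (H.e i)) ≠ 0 := by
      intro h0
      have h1 : Module.finrank ℂ (H.e i ⟶ H.e i) = 1 := H.isSimple i
      have : Subsingleton (H.e i ⟶ H.e i) :=
        ⟨fun f g => by rw [← Category.comp_id f, ← Category.comp_id g, h0, comp_zero, comp_zero]⟩
      rw [Module.finrank_zero_of_subsingleton] at h1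
      exact zero_ne_one h1
    rw [inner_self_eq_norm_sq (𝕜 := ℂ)]
    have := norm_pos_iff.2 h
    positivity⟩

/-- Linear `*`-functors between `H^*`-categories. -/
structure StarFunctor (H : Type u) [Category.{v} H] [HStarCategory H]
    (K : Type u') [Category.{v} K] [HStarCategory K] extends H ⥤ K where
  map_add' {x y : H} (f g : x ⟶ y) : map (f + g) = map f + map g
  map_smul' {x y : H} (a : ℂ) (f : x ⟶ y) : map (a • f) = a • map f
  map_dag' {x y : H} (f : x ⟶ y) : map (HStarCategory.dag f) = HStarCategory.dag (map f)

namespace StarFunctor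

variable {H : Type u} [Category.{v} H] [HStarCategory H]
  {K : Type u'} [Category.{v} K] [HStarCategory K]
  {L : Type u''} [Category.{v} L] [HStarCategory L]

/-- The identity `*`-functor. -/
def id (H : Type u) [Category.{v} H] [HStarCategory H] : StarFunctor H H where
  toFunctor := 𝟭 H
  map_add' _ _ := rfl
  map_smul' _ _ := rfl
  map_dag' _ := rfl

/-- The composite of two `*`-functors (first `F`, then `G`). -/
def comp (F : StarFunctor H K) (G : StarFunctor K L) : StarFunctor H L where
  toFunctor := F.toFunctor ⋙ G.toFunctor
  map_add' f g := by simp [F.map_add', G.map_add']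
  map_smul' a f := by simp [F.map_smul', G.map_smul']
  map_dag' f := by simp [F.map_dag', G.map_dag']

/-- The bilinear map `g ⊗ f ↦ G(f) g` (first `g`, then `G(f)`). -/
def postMap (G : StarFunctor H K) (z : K) (x y : H) :
    (z ⟶ G.obj x) →ₗ[ℂ] (x ⟶ y) →ₗ[ℂ] (z ⟶ G.obj y) :=
  LinearMap.mk₂ ℂ (fun g f => g ≫ G.map f)
    (fun g g' _ => HStarCategory.add_comp g g' _)
    (fun a g _ => HStarCategory.smul_comp a g _)
    (fun g f f' => by rw [G.map_add', HStarCategory.comp_add])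
    (fun a g f => by rw [G.map_smul', HStarCategory.comp_smul])

/-- Postcomposition with a morphism, as a linear map `Hom(z, x) → Hom(z, y)`. -/
def post (z : H) {x y : H} (θ : x ⟶ y) : (z ⟶ x) →ₗ[ℂ] (z ⟶ y) where
  toFun f := f ≫ θ
  map_add' f g := HStarCategory.add_comp f g θ
  map_smul' a f := HStarCategory.smul_comp a f θ

/-- Morphisms of linear `*`-functors: arbitrary natural transformations. -/
@[ext]
structure Hom (F G : StarFunctor H K) where
  nat : F.toFunctor ⟶ G.toFunctor

instance : Category (StarFunctor H K) where
  Hom F G := Hom F G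
  id F := ⟨𝟙 F.toFunctor⟩
  comp θ θ' := ⟨θ.nat ≫ θ'.nat⟩

/-- The natural isomorphism, as an isomorphism in the category of `*`-functors. -/
def isoOfNatIso {F G : StarFunctor H K} (α : F.toFunctor ≅ G.toFunctor) : F ≅ G where
  hom := ⟨α.hom⟩
  inv := ⟨α.inv⟩
  hom_inv_id := Hom.ext α.hom_inv_id
  inv_hom_id := Hom.ext α.inv_hom_id

end StarFunctor

/-- The 2-category of marked (finite-dimensional) 2-Hilbert spaces, linear `*`-functors (which
ignore the markings) and natural transformations. -/
instance : Bicategory MarkedTwoHilb.{v, u} where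
  Hom H K := StarFunctor H.carrier K.carrier
  id H := StarFunctor.id H.carrier
  comp F G := F.comp G
  homCategory H K := inferInstanceAs (Category (StarFunctor H.carrier K.carrier))
  whiskerLeft F _ _ θ := ⟨Functor.whiskerLeft F.toFunctor θ.nat⟩
  whiskerRight θ G := ⟨Functor.whiskerRight θ.nat G.toFunctor⟩
  associator F G K := StarFunctor.isoOfNatIso
    (Functor.associator F.toFunctor G.toFunctor K.toFunctor)
  leftUnitor F := StarFunctor.isoOfNatIso F.toFunctor.leftUnitor
  rightUnitor F := StarFunctor.isoOfNatIso F.toFunctor.rightUnitor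
  whiskerLeft_id F _ := StarFunctor.Hom.ext (Functor.whiskerLeft_id' F.toFunctor)
  whiskerLeft_comp F _ _ _ η θ :=
    StarFunctor.Hom.ext (Functor.whiskerLeft_comp F.toFunctor η.nat θ.nat)
  id_whiskerLeft η := StarFunctor.Hom.ext (NatTrans.ext (funext fun x =>
    ((Category.id_comp _).trans (Category.comp_id (η.nat.app x))).symm))
  comp_whiskerLeft F G _ _ η := StarFunctor.Hom.ext (NatTrans.ext (funext fun x =>
    ((Category.id_comp _).trans (Category.comp_id (η.nat.app (G.obj (F.obj x))))).symm))
  id_whiskerRight _ G := StarFunctor.Hom.ext (Functor.whiskerRight_id' G.toFunctor)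
  comp_whiskerRight η θ G :=
    StarFunctor.Hom.ext (Functor.whiskerRight_comp η.nat θ.nat G.toFunctor)
  whiskerRight_id η := StarFunctor.Hom.ext (NatTrans.ext (funext fun x =>
    ((Category.id_comp _).trans (Category.comp_id (η.nat.app x))).symm))
  whiskerRight_comp η G K := StarFunctor.Hom.ext (NatTrans.ext (funext fun x =>
    ((Category.id_comp _).trans (Category.comp_id (K.map (G.map (η.nat.app x))))).symm))
  whisker_assoc F _ _ η K := StarFunctor.Hom.ext (NatTrans.ext (funext fun x =>
    ((Category.id_comp _).trans (Category.comp_id (K.map (η.nat.app (F.obj x))))).symm))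
  whisker_exchange η θ := StarFunctor.Hom.ext (NatTrans.ext (funext fun x =>
    (θ.nat.naturality (η.nat.app x)).symm))
  pentagon F G K L :=
    StarFunctor.Hom.ext (Functor.pentagon F.toFunctor G.toFunctor K.toFunctor L.toFunctor)
  triangle F G := StarFunctor.Hom.ext (Functor.triangle F.toFunctor G.toFunctor)


/-! ## Finite spaces -/

/-- The weighted direct sum `⨁ i, c i • V i` of Hilbert spaces over an index set (the space of
sections of `V`), with inner product `∑ i, c i * (v i, w i)`. -/
def WSum {ι : Type w} (_c : ι → {r : ℝ // 0 < r}) (V : ι → Type v) : Type (max w v) := ∀ i, V i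

namespace WSum

variable {ι : Type w} {c : ι → {r : ℝ // 0 < r}} {V : ι → Type v} [Fintype ι]
  [∀ i, NormedAddCommGroup (V i)] [∀ i, InnerProductSpace ℂ (V i)]

/-- The inner product of the weighted direct sum. -/
@[reducible]
def core (c : ι → {r : ℝ // 0 < r}) (V : ι → Type v)
    [∀ i, NormedAddCommGroup (V i)] [∀ i, InnerProductSpace ℂ (V i)] :
    @InnerProductSpace.Core ℂ (WSum c V) _ (Pi.addCommGroup : AddCommGroup (∀ i, V i))
      (Pi.module ι V ℂ) :=
  letI : AddCommGroup (WSum c V) := (Pi.addCommGroup : AddCommGroup (∀ i, V i))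
  letI : Module ℂ (WSum c V) := Pi.module ι V ℂ
  { inner := fun v w => ∑ i, ((c i : ℝ) : ℂ) * inner ℂ (v i) (w i)
    conj_inner_symm := fun v w => by
      simp only [map_sum, map_mul, inner_conj_symm, Complex.conj_ofReal]
    re_inner_nonneg := fun v => by
      rw [map_sum]
      refine Finset.sum_nonneg fun i _ => ?_
      rw [inner_self_eq_norm_sq_to_K]
      have h : ((c i : ℝ) : ℂ) * ((‖v i‖ : ℝ) : ℂ) ^ 2 = ((c i * ‖v i‖ ^ 2 : ℝ) : ℂ) := by
        push_cast
        rfl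
      have h' := (c i).2
      refine le_of_le_of_eq (b := (c i * ‖v i‖ ^ 2 : ℝ)) (by positivity) ?_
      exact (congrArg Complex.re h).symm
    add_left := fun u v w => by
      rw [← Finset.sum_add_distrib]
      refine Finset.sum_congr rfl fun i _ => ?_
      rw [← mul_add, ← inner_add_left]
      rfl
    smul_left := fun v w r => by
      rw [Finset.mul_sum]
      refine Finset.sum_congr rfl fun i _ => ?_
      rw [mul_left_comm, ← inner_smul_left]
      rfl
    definite := fun v hv => by
      have h1 : ∑ i, (c i : ℝ) * ‖v i‖ ^ 2 = 0 := by
        have h2 : ((∑ i, (c i : ℝ) * ‖v i‖ ^ 2 : ℝ) : ℂ) = 0 := by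
          rw [← hv]
          push_cast
          refine Finset.sum_congr rfl fun i _ => ?_
          rw [inner_self_eq_norm_sq_to_K]
          rfl
        exact_mod_cast h2
      have h3 := (Finset.sum_eq_zero_iff_of_nonneg (fun i _ => by
        have := (c i).2
        positivity)).1 h1
      funext i
      have h4 := h3 i (Finset.mem_univ i)
      have h5 := (c i).2
      have h6 : ‖v i‖ ^ 2 = 0 := (mul_eq_zero.1 h4).resolve_left h5.ne'
      exact norm_eq_zero.1 (pow_eq_zero_iff two_ne_zero |>.1 h6) }

instance : NormedAddCommGroup (WSum c V) :=
  @InnerProductSpace.Core.toNormedAddCommGroup ℂ (WSum c V) _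
    (Pi.addCommGroup : AddCommGroup (∀ i, V i)) (Pi.module ι V ℂ) (core c V)

instance : InnerProductSpace ℂ (WSum c V) :=
  @InnerProductSpace.ofCore ℂ (WSum c V) _
    (Pi.addCommGroup : AddCommGroup (∀ i, V i)) (Pi.module ι V ℂ)
    (@InnerProductSpace.Core.toCore ℂ (WSum c V) _
      (Pi.addCommGroup : AddCommGroup (∀ i, V i)) (Pi.module ι V ℂ) (core c V))

theorem inner_def (v w : WSum c V) :
    inner ℂ v w = ∑ i, ((c i : ℝ) : ℂ) * inner ℂ (v i) (w i) := rfl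

/-- Evaluation at an index. -/
def eval (i : ι) : WSum c V →ₗ[ℂ] V i where
  toFun v := v i
  map_add' _ _ := rfl
  map_smul' _ _ := rfl

theorem ext {v w : WSum c V} (h : ∀ i, eval i v = eval i w) : v = w := funext h

/-- The weighted direct sum is linearly the product. -/
def toPi : WSum c V ≃ₗ[ℂ] (∀ i, V i) where
  toFun v := v
  invFun v := v
  map_add' _ _ := rfl
  map_smul' _ _ := rfl

instance [∀ i, FiniteDimensional ℂ (V i)] : FiniteDimensional ℂ (WSum c V) :=
  Module.Finite.equiv (toPi (c := c) (V := V)).symm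

open Classical in
/-- The inclusion of a summand. -/
def single (i : ι) : V i →ₗ[ℂ] WSum c V :=
  (toPi (c := c) (V := V)).symm.toLinearMap ∘ₗ LinearMap.single ℂ V i

/-- The linear map out of a direct sum with the given restrictions to the summands. -/
def lift {W : Type*} [AddCommGroup W] [Module ℂ W] (φ : ∀ i, V i →ₗ[ℂ] W) : WSum c V →ₗ[ℂ] W :=
  ∑ i, φ i ∘ₗ eval i

theorem eval_single_same (i : ι) (v : V i) : eval i (single (c := c) i v) = v := by
  classical
  change Pi.single i v i = v
  exact Pi.single_eq_same i v

theorem eval_single_ne {i j : ι} (h : j ≠ i) (v : V i) :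
    eval j (single (c := c) i v) = 0 := by
  classical
  change Pi.single i v j = 0
  exact Pi.single_eq_of_ne h v

@[simp]
theorem lift_single {W : Type*} [AddCommGroup W] [Module ℂ W] (φ : ∀ i, V i →ₗ[ℂ] W) (i : ι)
    (v : V i) : lift φ (single (c := c) i v) = φ i v := by
  rw [lift, LinearMap.sum_apply, Finset.sum_eq_single i]
  · rw [LinearMap.comp_apply, eval_single_same]
  · intro j _ hj
    rw [LinearMap.comp_apply, eval_single_ne hj, map_zero]
  · intro h
    exact absurd (Finset.mem_univ i) h

theorem sum_single (v : WSum c V) : ∑ i, single i (eval i v) = v := by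
  classical
  have := LinearMap.sum_single_apply V (toPi v)
  exact this

/-- Linear maps out of a direct sum agree if they agree on the summands. -/
theorem hom_ext {W : Type*} [AddCommGroup W] [Module ℂ W] {φ ψ : WSum c V →ₗ[ℂ] W}
    (h : ∀ i v, φ (single i v) = ψ (single i v)) : φ = ψ := by
  refine LinearMap.ext fun v => ?_
  rw [← sum_single v, map_sum, map_sum]
  exact Finset.sum_congr rfl fun i _ => h i _

end WSum

/-- A finite-dimensional complex Hilbert space. -/
structure FdHilb where
  carrier : Type v
  [normedAddCommGroup : NormedAddCommGroup carrier]
  [innerProductSpace : InnerProductSpace ℂ carrier]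
  [finiteDimensional : FiniteDimensional ℂ carrier]

namespace FdHilb

instance : CoeSort FdHilb.{v} (Type v) := ⟨carrier⟩

attribute [instance] normedAddCommGroup innerProductSpace finiteDimensional

end FdHilb

/-- A finite space: a finite set with a positive real scale factor `k x` for each point `x`. -/
structure FinSpace where
  carrier : Type v
  [fintype : Fintype carrier]
  k : carrier → {r : ℝ // 0 < r}

namespace FinSpace

instance : CoeSort FinSpace.{v} (Type v) := ⟨carrier⟩

attribute [instance] fintype

end FinSpace

/-- A bundle of Hilbert spaces over `Y × X`, regarded as a morphism `X → Y` of finite spaces;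
the fiber `⟨y|E|x⟩` is `E.fiber y x`. -/
structure HilbBundle (X Y : FinSpace.{v}) where
  fiber : Y → X → FdHilb.{v}

namespace HilbBundle

variable {X Y Z A B : FinSpace.{v}}

/-- A map of vector bundles: a family of linear maps between the fibers. -/
@[ext]
structure Hom (E F : HilbBundle X Y) where
  app (y : Y) (x : X) : E.fiber y x →ₗ[ℂ] F.fiber y x

instance : Category (HilbBundle X Y) where
  Hom E F := Hom E F
  id E := ⟨fun _ _ => LinearMap.id⟩
  comp f g := ⟨fun y x => g.app y x ∘ₗ f.app y x⟩

/-- The index set of the fiber `⟨y|id|x⟩`: one point if `y = x`, and empty otherwise. -/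
def DiagIndex (y x : X) : Type v := {_u : PUnit.{v + 1} // y = x}

instance (y x : X) : Fintype (DiagIndex y x) :=
  haveI : Finite (DiagIndex y x) := inferInstanceAs (Finite {_u : PUnit.{v + 1} // y = x})
  Fintype.ofFinite _

/-- The fiber `δ_{y,x} k_x ℂ`: a copy of `ℂ` with `(1, 1) = k_x` if `y = x`, and the zero space
(a direct sum over an empty set) otherwise. -/
abbrev IdFiber (y x : X) : Type v := WSum (fun _ : DiagIndex y x => X.k x) (fun _ => ℂ)

/-- The identity bundle, `⟨y|id|x⟩ = δ_{y,x} k_x ℂ`. -/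
def id (X : FinSpace.{v}) : HilbBundle X X where
  fiber y x := { carrier := IdFiber y x }

/-- The weighted direct sum `⨁ y, (1 / k_y) ⟨z|F|y⟩ ⊗ ⟨y|E|x⟩`. -/
abbrev ConvFiber (E : HilbBundle X Y) (F : HilbBundle Y Z) (z : Z) (x : X) : Type v :=
  WSum (fun y : Y => (Y.k y)⁻¹) (fun y => F.fiber z y ⊗[ℂ] E.fiber y x)

/-- Composition by convolution (first `E`, then `F`):
`⟨z|F ∘ E|x⟩ = ⨁ y, (1 / k_y) ⟨z|F|y⟩ ⊗ ⟨y|E|x⟩`. -/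
def comp (E : HilbBundle X Y) (F : HilbBundle Y Z) : HilbBundle X Z where
  fiber z x := { carrier := ConvFiber E F z x }

/-- The element `1` of a diagonal fiber of the identity bundle. -/
def one (x : X) : (id X).fiber x x :=
  (WSum.single ⟨PUnit.unit, rfl⟩ 1 : IdFiber x x)

/-- The linear map out of a fiber of the identity bundle sending `1` to `w rfl`. -/
def idDesc {W : Type*} [AddCommGroup W] [Module ℂ W] {y x : X} (w : y = x → W) :
    (id X).fiber y x →ₗ[ℂ] W :=
  (WSum.lift fun u => LinearMap.toSpanSingleton ℂ W (w u.2) : IdFiber y x →ₗ[ℂ] W)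

@[simp]
theorem idDesc_one {W : Type*} [AddCommGroup W] [Module ℂ W] {x : X} (w : x = x → W) :
    idDesc w (one x) = w rfl := by
  refine (WSum.lift_single _ _ _).trans ?_
  simp

theorem id_hom_ext {W : Type*} [AddCommGroup W] [Module ℂ W] {y x : X}
    {φ ψ : (id X).fiber y x →ₗ[ℂ] W}
    (h : ∀ e : y = x, φ (e ▸ one y) = ψ (e ▸ one y)) : φ = ψ := by
  refine WSum.hom_ext (c := fun _ : DiagIndex y x => X.k x) (V := fun _ => ℂ) ?_
  rintro ⟨⟨⟩, rfl⟩ a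
  have e : (WSum.single ⟨PUnit.unit, rfl⟩ a : IdFiber y y) =
      a • (WSum.single ⟨PUnit.unit, rfl⟩ 1 : IdFiber y y) := by
    rw [← map_smul, smul_eq_mul, mul_one]
  exact (congrArg φ e).trans (((map_smul φ a (one y)).trans
    ((congrArg (a • ·) (h rfl)).trans (map_smul ψ a (one y)).symm)).trans (congrArg ψ e).symm)

/-- The homogeneous element `f ⊗ e` of a fiber of a composite, in the summand indexed by `y`. -/
def tens {E : HilbBundle X Y} {F : HilbBundle Y Z} {z : Z} {x : X} (y : Y) :
    F.fiber z y →ₗ[ℂ] E.fiber y x →ₗ[ℂ] (E.comp F).fiber z x :=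
  (TensorProduct.mk ℂ (F.fiber z y) (E.fiber y x)).compr₂
    (WSum.single (c := fun y : Y => (Y.k y)⁻¹) (V := fun y => F.fiber z y ⊗[ℂ] E.fiber y x) y)

/-- The linear map out of a fiber of a composite determined by bilinear maps. -/
def desc {E : HilbBundle X Y} {F : HilbBundle Y Z} {z : Z} {x : X}
    {W : Type*} [AddCommGroup W] [Module ℂ W]
    (B : ∀ y, F.fiber z y →ₗ[ℂ] E.fiber y x →ₗ[ℂ] W) : (E.comp F).fiber z x →ₗ[ℂ] W :=
  (WSum.lift fun y => TensorProduct.lift (B y) : ConvFiber E F z x →ₗ[ℂ] W)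

@[simp]
theorem desc_tens {E : HilbBundle X Y} {F : HilbBundle Y Z} {z : Z} {x : X}
    {W : Type*} [AddCommGroup W] [Module ℂ W]
    (B : ∀ y, F.fiber z y →ₗ[ℂ] E.fiber y x →ₗ[ℂ] W) (y : Y) (f : F.fiber z y)
    (e : E.fiber y x) : desc B (tens y f e) = B y f e := by
  refine (WSum.lift_single (c := fun y : Y => (Y.k y)⁻¹)
    (V := fun y => F.fiber z y ⊗[ℂ] E.fiber y x) _ y (f ⊗ₜ[ℂ] e)).trans ?_
  exact TensorProduct.lift.tmul _ _

theorem tens_induction {E : HilbBundle X Y} {F : HilbBundle Y Z} {z : Z} {x : X}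
    {p : (E.comp F).fiber z x → Prop} (h0 : p 0) (hadd : ∀ v w, p v → p w → p (v + w))
    (ht : ∀ y f e, p (tens y f e)) (w : (E.comp F).fiber z x) : p w := by
  have h : ∀ s : Finset Y, p (∑ y ∈ s, WSum.single (c := fun y : Y => (Y.k y)⁻¹)
      (V := fun y => F.fiber z y ⊗[ℂ] E.fiber y x) y
      (WSum.eval (c := fun y : Y => (Y.k y)⁻¹) y w) : ConvFiber E F z x) := by
    intro s
    classical
    induction s using Finset.induction_on with
    | empty => exact h0
    | insert y s hy ih =>
      rw [Finset.sum_insert hy]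
      refine hadd _ _ ?_ ih
      generalize WSum.eval (c := fun y : Y => (Y.k y)⁻¹)
        (V := fun y => F.fiber z y ⊗[ℂ] E.fiber y x) y w = t
      induction t using TensorProduct.induction_on with
      | zero => rw [map_zero]; exact h0
      | tmul f e => exact ht y f e
      | add a b ha hb => rw [map_add]; exact hadd _ _ ha hb
  have h' := h Finset.univ
  exact Eq.mp (congrArg p (WSum.sum_single (c := fun y : Y => (Y.k y)⁻¹)
    (V := fun y => F.fiber z y ⊗[ℂ] E.fiber y x) w)) h'

theorem desc_ext {E : HilbBundle X Y} {F : HilbBundle Y Z} {z : Z} {x : X}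
    {W : Type*} [AddCommGroup W] [Module ℂ W] {φ ψ : (E.comp F).fiber z x →ₗ[ℂ] W}
    (h : ∀ y f e, φ (tens y f e) = ψ (tens y f e)) : φ = ψ := by
  refine LinearMap.ext fun w => ?_
  induction w using tens_induction with
  | h0 => simp
  | hadd v w hv hw => simp [hv, hw]
  | ht y f e => exact h y f e

/-- Whiskering of a map of bundles `η : F ⟶ G` by composition with a bundle `E` on the source
side: `f ⊗ e ↦ η f ⊗ e`. -/
def whiskerLeft (E : HilbBundle X Y) {F G : HilbBundle Y Z} (η : F ⟶ G) :
    E.comp F ⟶ E.comp G where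
  app z _ := desc fun y => tens y ∘ₗ η.app z y

/-- Whiskering of a map of bundles `η : E ⟶ F` by composition with a bundle `G` on the target
side: `g ⊗ e ↦ g ⊗ η e`. -/
def whiskerRight {E F : HilbBundle X Y} (η : E ⟶ F) (G : HilbBundle Y Z) :
    E.comp G ⟶ F.comp G where
  app _ x := desc fun y => (tens y).compl₂ (η.app y x)

@[simp]
theorem whiskerLeft_tens (E : HilbBundle X Y) {F G : HilbBundle Y Z} (η : F ⟶ G) (z : Z) (x : X)
    (y : Y) (f : F.fiber z y) (e : E.fiber y x) :
    (whiskerLeft E η).app z x (tens y f e) = tens y (η.app z y f) e := by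
  simp [whiskerLeft]

@[simp]
theorem whiskerRight_tens {E F : HilbBundle X Y} (η : E ⟶ F) (G : HilbBundle Y Z) (z : Z) (x : X)
    (y : Y) (g : G.fiber z y) (e : E.fiber y x) :
    (whiskerRight η G).app z x (tens y g e) = tens y g (η.app y x e) := by
  simp [whiskerRight]

/-- The fiberwise associator `k ⊗ (f ⊗ e) ↦ (k ⊗ f) ⊗ e`. -/
def assocHom (E : HilbBundle X Y) (F : HilbBundle Y Z) (K : HilbBundle Z A) :
    (E.comp F).comp K ⟶ E.comp (F.comp K) where
  app a x := desc fun z => LinearMap.mk₂ ℂ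
    (fun (k : K.fiber a z) (w : (E.comp F).fiber z x) =>
      desc (fun y => (tens y ∘ₗ tens z k :
        F.fiber z y →ₗ[ℂ] E.fiber y x →ₗ[ℂ] (E.comp (F.comp K)).fiber a x)) w)
    (fun k k' w => by
      induction w using tens_induction with
      | h0 => simp
      | hadd v w hv hw => rw [map_add, map_add, map_add, hv, hw]; abel
      | ht y f e => simp)
    (fun c k w => by
      induction w using tens_induction with
      | h0 => simp
      | hadd v w hv hw => rw [map_add, map_add, hv, hw, smul_add]
      | ht y f e => simp)
    (fun k w w' => map_add _ w w')
    (fun c k w => map_smul _ c w)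

/-- The inverse of the associator, `(k ⊗ f) ⊗ e ↦ k ⊗ (f ⊗ e)`. -/
def assocInv (E : HilbBundle X Y) (F : HilbBundle Y Z) (K : HilbBundle Z A) :
    E.comp (F.comp K) ⟶ (E.comp F).comp K where
  app a x := desc fun y => LinearMap.mk₂ ℂ
    (fun (w : (F.comp K).fiber a y) (e : E.fiber y x) =>
      desc (fun z => ((tens z).compl₂ ((tens y).flip e) :
        K.fiber a z →ₗ[ℂ] F.fiber z y →ₗ[ℂ] ((E.comp F).comp K).fiber a x)) w)
    (fun w w' e => map_add _ w w')
    (fun c w e => map_smul _ c w)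
    (fun w e e' => by
      induction w using tens_induction with
      | h0 => simp
      | hadd v w hv hw => rw [map_add, map_add, map_add, hv, hw]; abel
      | ht z k f => simp)
    (fun c w e => by
      induction w using tens_induction with
      | h0 => simp
      | hadd v w hv hw => rw [map_add, map_add, hv, hw, smul_add]
      | ht z k f => simp)

@[simp]
theorem assocHom_tens (E : HilbBundle X Y) (F : HilbBundle Y Z) (K : HilbBundle Z A)
    (a : A) (x : X) (z : Z) (y : Y) (k : K.fiber a z) (f : F.fiber z y) (e : E.fiber y x) :
    (assocHom E F K).app a x (tens z k (tens y f e)) = tens y (tens z k f) e := by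
  simp [assocHom]

@[simp]
theorem assocInv_tens (E : HilbBundle X Y) (F : HilbBundle Y Z) (K : HilbBundle Z A)
    (a : A) (x : X) (z : Z) (y : Y) (k : K.fiber a z) (f : F.fiber z y) (e : E.fiber y x) :
    (assocInv E F K).app a x (tens y (tens z k f) e) = tens z k (tens y f e) := by
  simp [assocInv]

/-- The right unit constraint `E ∘ id ⟶ E`, `e ⊗ 1 ↦ e`. -/
def compIdHom (E : HilbBundle X Y) : (id X).comp E ⟶ E where
  app y x := desc fun x' => (idDesc fun h : x' = x => h ▸ LinearMap.id :
    (id X).fiber x' x →ₗ[ℂ] (E.fiber y x' →ₗ[ℂ] E.fiber y x)).flip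

/-- The inverse `e ↦ e ⊗ 1`. -/
def compIdInv (E : HilbBundle X Y) : E ⟶ (id X).comp E where
  app _ x := (tens x).flip (one x)

/-- The left unit constraint `id ∘ E ⟶ E`, `1 ⊗ e ↦ e`. -/
def idCompHom (E : HilbBundle X Y) : E.comp (id Y) ⟶ E where
  app y x := desc fun y' => (idDesc fun h : y = y' => h ▸ LinearMap.id :
    (id Y).fiber y y' →ₗ[ℂ] (E.fiber y' x →ₗ[ℂ] E.fiber y x))

/-- The inverse `e ↦ 1 ⊗ e`. -/
def idCompInv (E : HilbBundle X Y) : E ⟶ E.comp (id Y) where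
  app y _ := tens y (one y)

@[simp]
theorem compIdHom_tens (E : HilbBundle X Y) (y : Y) (x : X) (e : E.fiber y x) :
    (compIdHom E).app y x (tens x e (one x)) = e := by
  simp [compIdHom]

@[simp]
theorem idCompHom_tens (E : HilbBundle X Y) (y : Y) (x : X) (e : E.fiber y x) :
    (idCompHom E).app y x (tens y (one y) e) = e := by
  simp [idCompHom]

@[simp]
theorem compIdInv_app (E : HilbBundle X Y) (y : Y) (x : X) (e : E.fiber y x) :
    (compIdInv E).app y x e = tens x e (one x) := rfl

@[simp]
theorem idCompInv_app (E : HilbBundle X Y) (y : Y) (x : X) (e : E.fiber y x) :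
    (idCompInv E).app y x e = tens y (one y) e := rfl

theorem compId_ext {E : HilbBundle X Y} {y : Y} {x : X}
    {W : Type*} [AddCommGroup W] [Module ℂ W] {φ ψ : ((id X).comp E).fiber y x →ₗ[ℂ] W}
    (h : ∀ e, φ (tens x e (one x)) = ψ (tens x e (one x))) : φ = ψ := by
  refine desc_ext fun x' e c => ?_
  have : φ ∘ₗ tens x' e = ψ ∘ₗ tens x' e := id_hom_ext fun hx => by
    subst hx
    exact h e
  exact LinearMap.congr_fun this c

theorem idComp_ext {E : HilbBundle X Y} {y : Y} {x : X}
    {W : Type*} [AddCommGroup W] [Module ℂ W] {φ ψ : (E.comp (id Y)).fiber y x →ₗ[ℂ] W}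
    (h : ∀ e, φ (tens y (one y) e) = ψ (tens y (one y) e)) : φ = ψ := by
  refine desc_ext fun y' c e => ?_
  have : φ ∘ₗ (tens y').flip e = ψ ∘ₗ (tens y').flip e := id_hom_ext fun hy => by
    subst hy
    exact h e
  exact LinearMap.congr_fun this c

@[simp]
theorem comp_app {E F G : HilbBundle X Y} (f : E ⟶ F) (g : F ⟶ G) (y : Y) (x : X)
    (e : E.fiber y x) : (f ≫ g).app y x e = g.app y x (f.app y x e) := rfl

@[simp]
theorem id_app (E : HilbBundle X Y) (y : Y) (x : X)
    (e : E.fiber y x) : (𝟙 E : E ⟶ E).app y x e = e := rfl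

theorem hom_ext {E F : HilbBundle X Y} {f g : E ⟶ F} (h : ∀ y x, f.app y x = g.app y x) :
    f = g :=
  Hom.ext (funext fun y => funext fun x => h y x)

theorem ext_comp {E : HilbBundle X Y} {F : HilbBundle Y Z} {G : HilbBundle X Z}
    {φ ψ : E.comp F ⟶ G}
    (h : ∀ z x y f e, φ.app z x (tens y f e) = ψ.app z x (tens y f e)) : φ = ψ :=
  hom_ext fun z x => desc_ext (h z x)

theorem ext_comp_left {E : HilbBundle X Y} {F : HilbBundle Y Z} {K : HilbBundle Z A}
    {G : HilbBundle X A} {φ ψ : (E.comp F).comp K ⟶ G}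
    (h : ∀ a x z y k f e, φ.app a x (tens z k (tens y f e)) =
      ψ.app a x (tens z k (tens y f e))) : φ = ψ :=
  ext_comp fun a x z k w => by
    induction w using tens_induction with
    | h0 => simp
    | hadd v w hv hw => simp [hv, hw]
    | ht y f e => exact h a x z y k f e

theorem ext_comp_right {E : HilbBundle X Y} {F : HilbBundle Y Z} {K : HilbBundle Z A}
    {G : HilbBundle X A} {φ ψ : E.comp (F.comp K) ⟶ G}
    (h : ∀ a x z y k f e, φ.app a x (tens y (tens z k f) e) =
      ψ.app a x (tens y (tens z k f) e)) : φ = ψ :=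
  ext_comp fun a x y w e => by
    induction w using tens_induction with
    | h0 => simp
    | hadd v w hv hw => simp [hv, hw]
    | ht z k f => exact h a x z y k f e

/-- The associator of finite spaces. -/
def associator (E : HilbBundle X Y) (F : HilbBundle Y Z) (K : HilbBundle Z A) :
    (E.comp F).comp K ≅ E.comp (F.comp K) where
  hom := assocHom E F K
  inv := assocInv E F K
  hom_inv_id := ext_comp_left fun a x z y k f e => by simp
  inv_hom_id := ext_comp_right fun a x z y k f e => by simp

/-- The constraint `E ∘ id ≅ E`. -/
def compIdIso (E : HilbBundle X Y) : (id X).comp E ≅ E where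
  hom := compIdHom E
  inv := compIdInv E
  hom_inv_id := hom_ext fun y x => compId_ext fun e => by simp
  inv_hom_id := hom_ext fun y x => LinearMap.ext fun e => by simp

/-- The constraint `id ∘ E ≅ E`. -/
def idCompIso (E : HilbBundle X Y) : E.comp (id Y) ≅ E where
  hom := idCompHom E
  inv := idCompInv E
  hom_inv_id := hom_ext fun y x => idComp_ext fun e => by simp
  inv_hom_id := hom_ext fun y x => LinearMap.ext fun e => by simp

theorem whiskerLeft_comp' (E : HilbBundle X Y) {F G K : HilbBundle Y Z} (η : F ⟶ G)
    (θ : G ⟶ K) : whiskerLeft E (η ≫ θ) = whiskerLeft E η ≫ whiskerLeft E θ :=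
  ext_comp fun z x y f e => by simp

theorem id_whiskerLeft' {E F : HilbBundle X Y} (η : E ⟶ F) :
    whiskerLeft (id X) η = compIdHom E ≫ η ≫ compIdInv F :=
  hom_ext fun y x => compId_ext fun e => by simp

theorem comp_whiskerLeft' (E : HilbBundle X Y) (F : HilbBundle Y Z) {K K' : HilbBundle Z A}
    (η : K ⟶ K') : whiskerLeft (E.comp F) η =
      assocHom E F K ≫ whiskerLeft E (whiskerLeft F η) ≫ assocInv E F K' :=
  ext_comp_left fun a x z y k f e => by simp

theorem comp_whiskerRight' {E F G : HilbBundle X Y} (η : E ⟶ F) (θ : F ⟶ G)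
    (K : HilbBundle Y Z) : whiskerRight (η ≫ θ) K = whiskerRight η K ≫ whiskerRight θ K :=
  ext_comp fun z x y f e => by simp

theorem whiskerRight_id' {E F : HilbBundle X Y} (η : E ⟶ F) :
    whiskerRight η (id Y) = idCompHom E ≫ η ≫ idCompInv F :=
  hom_ext fun y x => idComp_ext fun e => by simp

theorem whiskerRight_comp' {E E' : HilbBundle X Y} (η : E ⟶ E') (F : HilbBundle Y Z)
    (K : HilbBundle Z A) : whiskerRight η (F.comp K) =
      assocInv E F K ≫ whiskerRight (whiskerRight η F) K ≫ assocHom E' F K :=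
  ext_comp_right fun a x z y k f e => by simp

theorem whisker_assoc' (E : HilbBundle X Y) {F F' : HilbBundle Y Z} (η : F ⟶ F')
    (K : HilbBundle Z A) : whiskerRight (whiskerLeft E η) K =
      assocHom E F K ≫ whiskerLeft E (whiskerRight η K) ≫ assocInv E F' K :=
  ext_comp_left fun a x z y k f e => by simp

theorem whisker_exchange' {E F : HilbBundle X Y} {G K : HilbBundle Y Z} (η : E ⟶ F)
    (θ : G ⟶ K) : whiskerLeft E θ ≫ whiskerRight η K = whiskerRight η G ≫ whiskerLeft F θ :=
  ext_comp fun z x y f e => by simp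

theorem pentagon' (E : HilbBundle X Y) (F : HilbBundle Y Z) (G : HilbBundle Z A)
    (K : HilbBundle A B) :
    whiskerRight (assocHom E F G) K ≫ assocHom E (F.comp G) K ≫ whiskerLeft E (assocHom F G K) =
      assocHom (E.comp F) G K ≫ assocHom E F (G.comp K) :=
  ext_comp_left fun b x a z k g w => by
    induction w using tens_induction with
    | h0 => simp
    | hadd v w hv hw =>
      rw [map_add, map_add, map_add, map_add, hv, hw]
    | ht y f e => simp

theorem triangle' (E : HilbBundle X Y) (F : HilbBundle Y Z) :
    assocHom E (id Y) F ≫ whiskerLeft E (compIdHom F) = whiskerRight (idCompHom E) F :=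
  ext_comp fun z x y f w => by
    have h : ((assocHom E (id Y) F ≫ whiskerLeft E (compIdHom F)).app z x) ∘ₗ tens y f =
        ((whiskerRight (idCompHom E) F).app z x) ∘ₗ tens y f :=
      idComp_ext fun e => by simp
    exact LinearMap.congr_fun h w

end HilbBundle

open HilbBundle in
/-- The 2-category of finite spaces, bundles of Hilbert spaces and maps of vector bundles. -/
instance : Bicategory FinSpace.{v} where
  Hom X Y := HilbBundle X Y
  id X := HilbBundle.id X
  comp E F := E.comp F
  homCategory X Y := inferInstanceAs (Category (HilbBundle X Y))
  whiskerLeft E _ _ η := HilbBundle.whiskerLeft E η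
  whiskerRight η G := HilbBundle.whiskerRight η G
  associator E F K := HilbBundle.associator E F K
  leftUnitor E := HilbBundle.compIdIso E
  rightUnitor E := HilbBundle.idCompIso E
  whiskerLeft_id E F := ext_comp fun z x y f e =>
    HilbBundle.whiskerLeft_tens E (𝟙 (F : HilbBundle _ _)) z x y f e
  whiskerLeft_comp E _ _ _ η θ := whiskerLeft_comp' E η θ
  id_whiskerLeft η := id_whiskerLeft' η
  comp_whiskerLeft E F _ _ η := comp_whiskerLeft' E F η
  id_whiskerRight E F := ext_comp fun z x y f e =>
    HilbBundle.whiskerRight_tens (𝟙 (E : HilbBundle _ _)) F z x y f e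
  comp_whiskerRight η θ K := comp_whiskerRight' η θ K
  whiskerRight_id η := whiskerRight_id' η
  whiskerRight_comp η F K := whiskerRight_comp' η F K
  whisker_assoc E _ _ η K := whisker_assoc' E η K
  whisker_exchange η θ := whisker_exchange' η θ
  pentagon E F G K := pentagon' E F G K
  triangle E F := triangle' E F

/-! ## The 2-functor -/

namespace MarkedTwoHilb

variable {H K L : MarkedTwoHilb.{v, u}}

/-- The finite space `⟨H⟩` of marked simple objects, with their scale factors. -/
def space (H : MarkedTwoHilb.{v, u}) : FinSpace.{v} where
  carrier := H.ι
  k := H.scale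

/-- The bundle `⟨F⟩` of a linear `*`-functor `F : H → K`, `⟨μ|F|i⟩ = Hom(e_μ, F e_i)`. -/
def bundle (F : H ⟶ K) : H.space ⟶ K.space where
  fiber μ i := { carrier := K.e μ ⟶ F.obj (H.e i) }

/-- The map of bundles `⟨θ⟩` of a natural transformation: postcomposition with `θ_{e_i}`. -/
def bundleMap {F G : H ⟶ K} (θ : F ⟶ G) : bundle F ⟶ bundle G where
  app μ i := StarFunctor.post (K.e μ) (θ.nat.app (H.e i))

/-- The compositor `⟨G⟩ ∘ ⟨F⟩ ⟶ ⟨G ∘ F⟩`: for `g : e_λ → G e_μ` and `f : e_μ → F e_i`, it sends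
`g ⊗ f` to the composite of `g` followed by `G(f)`. -/
def compositor (F : H ⟶ K) (G : K ⟶ L) : bundle F ≫ bundle G ⟶ bundle (F ≫ G) where
  app l i := HilbBundle.desc (E := bundle F) (F := bundle G) (W := (bundle (F ≫ G)).fiber l i)
    fun μ => StarFunctor.postMap G (L.e l) (K.e μ) (F.obj (H.e i))

/-- The unit coherence map `id_{⟨H⟩} ⟶ ⟨id_H⟩`, fiberwise `1 ↦ id_{e_i}`. -/
def unitor (H : MarkedTwoHilb.{v, u}) : 𝟙 H.space ⟶ bundle (𝟙 H) where
  app j i := HilbBundle.idDesc (W := (bundle (𝟙 H)).fiber j i)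
    fun h : j = i => (eqToHom (congrArg H.e h) : H.e j ⟶ H.e i)

theorem compositor_tens (F : H ⟶ K) (G : K ⟶ L) (l : L.ι) (i : H.ι) (μ : K.ι)
    (g : L.e l ⟶ G.obj (K.e μ)) (f : K.e μ ⟶ F.obj (H.e i)) :
    (compositor F G).app l i
      (HilbBundle.tens (E := bundle F) (F := bundle G) (z := l) (x := i) μ g f) =
      (g ≫ G.map f : L.e l ⟶ G.obj (F.obj (H.e i))) :=
  HilbBundle.desc_tens (E := bundle F) (F := bundle G) (W := (bundle (F ≫ G)).fiber l i) _ _ _ _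

theorem unitor_one (H : MarkedTwoHilb.{v, u}) (i : H.ι) :
    (unitor H).app i i (HilbBundle.one (X := H.space) i) = 𝟙 (H.e i) :=
  HilbBundle.idDesc_one (X := H.space) (W := (bundle (𝟙 H)).fiber i i) _

open HilbBundle in
/-- The assignment `⟨·⟩` on objects, morphisms and 2-morphisms, with its coherence maps. -/
def bracket : LaxFunctor MarkedTwoHilb.{v, u} FinSpace.{v} where
  obj H := H.space
  map F := bundle F
  map₂ θ := bundleMap θ
  map₂_id F := hom_ext fun μ i => LinearMap.ext fun f => Category.comp_id f
  map₂_comp θ θ' := hom_ext fun μ i => LinearMap.ext fun f =>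
    (Category.assoc f (θ.nat.app _) (θ'.nat.app _)).symm
  mapId H := unitor H
  mapComp F G := compositor F G
  mapComp_naturality_left {H K L F F'} η G := by
    refine ext_comp (E := bundle F) (F := bundle G) fun l i μ g f => ?_
    have h1 := congrArg ((bundleMap (η ▷ G)).app l i) (compositor_tens F G l i μ g f)
    have h2 := congrArg ((compositor F' G).app l i)
      (HilbBundle.whiskerRight_tens (bundleMap η) (bundle G) l i μ g f)
    have h3 := compositor_tens F' G l i μ g ((bundleMap η).app μ i f)
    refine h1.trans (Eq.trans ?_ (h2.trans h3).symm)
    change (g ≫ G.map f) ≫ G.map (η.nat.app (H.e i)) = g ≫ G.map (f ≫ η.nat.app (H.e i))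
    exact (Category.assoc g (G.map f) _).trans
      (congrArg (g ≫ ·) (G.map_comp f (η.nat.app (H.e i))).symm)
  mapComp_naturality_right {H K L} F G G' η := by
    refine ext_comp (E := bundle F) (F := bundle G) fun l i μ g f => ?_
    have h1 := congrArg ((bundleMap (F ◁ η)).app l i) (compositor_tens F G l i μ g f)
    have h2 := congrArg ((compositor F G').app l i)
      (HilbBundle.whiskerLeft_tens (bundle F) (bundleMap η) l i μ g f)
    have h3 := compositor_tens F G' l i μ ((bundleMap η).app l μ g) f
    refine h1.trans (Eq.trans ?_ (h2.trans h3).symm)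
    change (g ≫ G.map f) ≫ η.nat.app (F.obj (H.e i)) = (g ≫ η.nat.app (K.e μ)) ≫ G'.map f
    exact (Category.assoc g (G.map f) _).trans
      ((congrArg (g ≫ ·) (η.nat.naturality f)).trans (Category.assoc g _ _).symm)
  map₂_associator {H K L M} F G N := by
    refine ext_comp_left (E := bundle F) (F := bundle G) (K := bundle N)
      fun a i l μ n g f => ?_
    have l1 := HilbBundle.whiskerRight_tens (compositor F G) (bundle N) a i l n
      (HilbBundle.tens (E := bundle F) (F := bundle G) μ g f)
    have l2 := congrArg (HilbBundle.tens (E := bundle (F ≫ G)) (F := bundle N)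
      (z := a) (x := i) l n) (compositor_tens F G l i μ g f)
    have l3 := compositor_tens (F ≫ G) N a i l n (g ≫ G.map f)
    have r1 := HilbBundle.assocHom_tens (bundle F) (bundle G) (bundle N) a i l μ n g f
    have r2 := HilbBundle.whiskerLeft_tens (bundle F) (compositor G N) a i μ
      (HilbBundle.tens (E := bundle G) (F := bundle N) l n g) f
    have r3 := congrArg (fun t => HilbBundle.tens (E := bundle F) (F := bundle (G ≫ N))
      (z := a) (x := i) μ t f) (compositor_tens G N a μ l n g)
    have r4 := compositor_tens F (G ≫ N) a i μ (n ≫ N.map g) f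
    have hl := congrArg ((bundleMap (α_ F G N).hom).app a i)
      ((congrArg ((compositor (F ≫ G) N).app a i) (l1.trans l2)).trans l3)
    have hr := (congrArg ((compositor F (G ≫ N)).app a i)
      ((congrArg ((HilbBundle.whiskerLeft (bundle F) (compositor G N)).app a i) r1).trans
        (r2.trans r3))).trans r4
    refine hl.trans (Eq.trans ?_ hr.symm)
    change (n ≫ N.map (g ≫ G.map f)) ≫ 𝟙 _ = (n ≫ N.map g) ≫ N.map (G.map f)
    exact (Category.comp_id _).trans ((congrArg (n ≫ ·) (N.map_comp g (G.map f))).trans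
      (Category.assoc n _ _).symm)
  map₂_leftUnitor {H K} F := by
    refine hom_ext fun μ i => LinearMap.ext fun f => ?_
    have h1 := congrArg ((compositor (𝟙 H) F).app μ i)
      (HilbBundle.whiskerRight_tens (unitor H) (bundle F) μ i i f (HilbBundle.one (X := H.space) i))
    have h2 := compositor_tens (𝟙 H) F μ i i f
      ((unitor H).app i i (HilbBundle.one (X := H.space) i))
    refine Eq.trans ?_ (h1.trans h2).symm
    have h3 : f ≫ F.map (𝟙 (H.e i)) = f ≫ 𝟙 (F.obj (H.e i)) :=
      congrArg (f ≫ ·) (F.map_id (H.e i))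
    exact ((congrArg (fun t : H.e i ⟶ H.e i => f ≫ F.map t) (unitor_one H i)).trans h3).symm
  map₂_rightUnitor {H K} F := by
    refine hom_ext fun μ i => LinearMap.ext fun f => ?_
    have h1 := congrArg ((compositor F (𝟙 K)).app μ i)
      (HilbBundle.whiskerLeft_tens (bundle F) (unitor K) μ i μ (HilbBundle.one (X := K.space) μ) f)
    have h2 := compositor_tens F (𝟙 K) μ i μ
      ((unitor K).app μ μ (HilbBundle.one (X := K.space) μ)) f
    refine Eq.trans ?_ (h1.trans h2).symm
    have h3 : f ≫ 𝟙 (F.obj (H.e i)) = 𝟙 (K.e μ) ≫ f :=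
      (Category.comp_id f).trans (Category.id_comp f).symm
    exact h3.trans (congrArg (fun t : K.e μ ⟶ K.e μ => t ≫ f) (unitor_one K μ)).symm

end MarkedTwoHilb

/-! ## Linear structure and inner products on 2-morphisms -/

section TwoMorphisms

variable {H K : MarkedTwoHilb.{v, u}} {X Y : FinSpace.{v}}

/-- 2-morphisms of marked 2-Hilbert spaces are natural transformations. -/
def natEquiv (F G : H ⟶ K) :
    (F ⟶ G) ≃ (StarFunctor.toFunctor F ⟶ StarFunctor.toFunctor G) where
  toFun θ := θ.nat
  invFun θ := ⟨θ⟩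

instance (F G : H ⟶ K) : AddCommGroup (F ⟶ G) := (natEquiv F G).addCommGroup

instance (F G : H ⟶ K) : Module ℂ (F ⟶ G) := (natEquiv F G).module ℂ

/-- 2-morphisms of finite spaces are families of linear maps. -/
def bundleEquiv (E F : X ⟶ Y) :
    (E ⟶ F) ≃ (∀ (y : Y) (x : X), HilbBundle.fiber E y x →ₗ[ℂ] HilbBundle.fiber F y x) where
  toFun f := f.app
  invFun f := ⟨f⟩

instance (E F : X ⟶ Y) : AddCommGroup (E ⟶ F) := (bundleEquiv E F).addCommGroup

instance (E F : X ⟶ Y) : Module ℂ (E ⟶ F) := (bundleEquiv E F).module ℂ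

/-- The inner product of natural transformations, `∑ i, k_i (θ_{e_i}, θ'_{e_i})`. -/
def natInner {F G : H ⟶ K} (θ θ' : F ⟶ G) : ℂ :=
  ∑ i : H.ι, ((H.scale i : ℝ) : ℂ) * inner ℂ (θ.nat.app (H.e i)) (θ'.nat.app (H.e i))

/-- The inner product of maps of bundles, `∑ x y, k_x k_y Tr (f_{y,x}^* g_{y,x})`. -/
def bundleInner {E F : X ⟶ Y} (f g : E ⟶ F) : ℂ :=
  ∑ x : X, ∑ y : Y, ((X.k x : ℝ) : ℂ) * ((Y.k y : ℝ) : ℂ) *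
    LinearMap.trace ℂ _ (LinearMap.adjoint (f.app y x) ∘ₗ g.app y x)

/-- A map of bundles is unitary if it is unitary on each fiber. -/
def IsUnitaryCell {E F : X ⟶ Y} (f : E ⟶ F) : Prop :=
  ∀ (y : Y) (x : X), LinearMap.adjoint (f.app y x) ∘ₗ f.app y x = LinearMap.id ∧
    f.app y x ∘ₗ LinearMap.adjoint (f.app y x) = LinearMap.id

end TwoMorphisms

/-- A weak 2-functor is an equivalence of 2-categories if it is an equivalence on hom-categories
and essentially surjective: every object of the target is equivalent, inside the target, to
an object in the image. -/
def IsTwoEquivalence {B : Type u} [Bicategory.{w, v} B] {C : Type u'} [Bicategory.{w', v'} C]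
    (Φ : Pseudofunctor B C) : Prop :=
  (∀ a b : B, (Φ.mapFunctor a b).IsEquivalence) ∧
    ∀ c : C, ∃ b : B, Nonempty (Φ.obj b ≌ c)

end

/-! A finite-dimensional 2-Hilbert space is semisimple, in an orthogonal form that keeps track of
inner products. By Schur's lemma (`comp_dag_eq`, `hom_eq_zero`), for f, g : e_i → x the endomorphism
g^* f is the scalar (g, f)/k_i, and maps between different marked simples vanish. Hence an
orthonormal basis of Hom(e_i, x), rescaled by √k_i, consists of isometries with orthogonal ranges
(`frame`), and over all i their range projections sum to id_x (`sum_dag_comp_frame`). Nothing is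
missed because of `eq_zero_of_comp_eq_zero`: an endomorphism algebra of dimension at least two
contains a nontrivial idempotent, found by orthogonal projection onto a one-sided ideal, and
splitting it lowers the dimension.

The rest follows from this resolution of the identity. For the compositor, (G(f)g, G(f')g') = (g,
G(f^* f')g') = (g, g')(f, f')/k_μ, which is the inner product on composites of bundles; surjectivity
comes from applying G to the resolution of the identity of F e_i. The unit maps are Schur's lemma
again. A natural transformation amounts to arbitrary components at the marked simples
(`natOfComponents`), and a morphism to its action on the spaces Hom(e_μ, -) (`ofPost`), so
2-morphisms correspond bijectively; the inner products agree because the weighted traces sum to (f,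
g) (`sum_scale_mul_trace`).

Since 2-morphisms of finite spaces are arbitrary linear maps, a bundle is determined up to
isomorphism by its fibre dimensions, so it is enough to build a *-functor with prescribed
multiplicities (`ofMultiplicities`). Finally, a finite space X is the space of marked simples of a
category of matrix families over X, with trace form weighted by k_x. -/

noncomputable section

/-! ### Idempotents in endomorphism algebras of an H^*-category -/

namespace HStarCategory

variable {H : Type u} [Category.{v} H] [HStarCategory H]

theorem dag_zero {x y : H} : dag (0 : x ⟶ y) = 0 := by
  have h := dag_smul (0 : ℂ) (0 : x ⟶ y)
  simpa using h

theorem dag_id (x : H) : dag (𝟙 x) = 𝟙 x := by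
  have h := dag_comp (dag (𝟙 x)) (𝟙 x)
  rw [Category.comp_id, dag_dag, Category.comp_id] at h
  exact h.symm

theorem dag_sum {x y : H} {J : Type*} (s : Finset J) (f : J → (x ⟶ y)) :
    dag (∑ j ∈ s, f j) = ∑ j ∈ s, dag (f j) := by
  classical
  induction s using Finset.induction_on with
  | empty => simpa using dag_zero
  | insert a s ha ih => rw [Finset.sum_insert ha, Finset.sum_insert ha, dag_add, ih]

/-- An endomorphism algebra of dimension at least two contains a nontrivial idempotent. -/
theorem exists_idempotent {x : H} (hx : 1 < Module.finrank ℂ (x ⟶ x)) :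
    ∃ p : x ⟶ x, p ≫ p = p ∧ p ≠ 0 ∧ p ≠ 𝟙 x := by
  obtain ⟨f, hf⟩ : ∃ f : x ⟶ x, ∀ c : ℂ, c • 𝟙 x ≠ f := by
    by_contra! h
    exact absurd (finrank_le_one (𝟙 x) h) (by omega)
  have : Nontrivial (x ⟶ x) := Module.nontrivial_of_finrank_pos (R := ℂ) (by omega)
  obtain ⟨c, hc⟩ := Module.End.exists_eigenvalue (Linear.rightComp ℂ x f : (x ⟶ x) →ₗ[ℂ] (x ⟶ x))
  obtain ⟨a₀, ha₀⟩ := hc.exists_hasEigenvector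
  -- This eigenspace is nonzero, stable under precomposition, and does not contain the identity
  -- because f is not scalar. Projecting the identity onto it gives the idempotent.
  let I : Submodule ℂ (x ⟶ x) := Module.End.eigenspace (Linear.rightComp ℂ x f) c
  have memI (a : x ⟶ x) : a ∈ I ↔ a ≫ f = c • a := Module.End.mem_eigenspace_iff
  have hI (b a : x ⟶ x) (ha : a ∈ I) : b ≫ a ∈ I := by
    rw [memI] at ha ⊢
    rw [Category.assoc, ha, comp_smul]
  let p : x ⟶ x := I.starProjection (𝟙 x)
  have hp : p ∈ I := I.starProjection_apply_mem _
  -- Through `dag`, stability of I under precomposition passes to its orthogonal complement. The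
  -- projection therefore commutes with precomposition and is determined by its value p at the
  -- identity.
  have hproj (a : x ⟶ x) : I.starProjection a = a ≫ p := by
    refine Submodule.eq_starProjection_of_mem_of_inner_eq_zero (hI a p hp) fun b hb => ?_
    have h := I.starProjection_inner_eq_zero (𝟙 x) (dag a ≫ b) (hI _ _ hb)
    have h2 := inner_comp_right (dag a) b (𝟙 x - p)
    rw [dag_dag, Preadditive.comp_sub, Category.comp_id] at h2
    rw [← inner_conj_symm, ← h2, inner_conj_symm]
    exact h
  refine ⟨p, ?_, ?_, ?_⟩
  · rw [← hproj p]
    exact Submodule.starProjection_eq_self_iff.2 hp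
  · intro h0
    apply ha₀.2
    rw [← Submodule.starProjection_eq_self_iff.2 ha₀.1]
    exact (hproj a₀).trans (by rw [h0, comp_zero])
  · intro h1
    rw [h1, memI, Category.id_comp] at hp
    exact hf c hp.symm

/-- The corner embedding a ↦ r ≫ a ≫ i misses the nonzero element 𝟙 x - r ≫ i, which compresses to
zero on y. This makes splitting an idempotent an induction step. -/
theorem finrank_end_lt_of_split {x y : H} (i : y ⟶ x) (r : x ⟶ y) (hir : i ≫ r = 𝟙 y)
    (h : r ≫ i ≠ 𝟙 x) : Module.finrank ℂ (y ⟶ y) < Module.finrank ℂ (x ⟶ x) := by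
  let φ : (y ⟶ y) →ₗ[ℂ] (x ⟶ x) := Linear.leftComp ℂ x r ∘ₗ Linear.rightComp ℂ y i
  have hφ (a : y ⟶ y) : φ a = r ≫ a ≫ i := rfl
  have hinj : Function.Injective φ := fun a b hab => by
    rw [hφ, hφ] at hab
    have := congrArg (fun t => i ≫ t ≫ r) hab
    simpa [hir, reassoc_of% hir] using this
  rw [← LinearMap.finrank_range_of_inj hinj]
  refine Submodule.finrank_lt fun htop => ?_
  have hmem : 𝟙 x - r ≫ i ∈ LinearMap.range φ := htop ▸ Submodule.mem_top
  obtain ⟨a, ha⟩ := hmem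
  rw [hφ] at ha
  have h1 : a = 0 := by
    have := congrArg (fun t => i ≫ t ≫ r) ha
    simpa [hir, reassoc_of% hir, Preadditive.comp_sub, Preadditive.sub_comp] using this
  rw [h1, zero_comp, comp_zero] at ha
  exact h (sub_eq_zero.1 ha.symm).symm

end HStarCategory

/-! ### Semisimplicity: Schur's lemma and the resolution of the identity -/

namespace MarkedTwoHilb

open HStarCategory

variable (H : MarkedTwoHilb.{v, u})

/-- A morphism is zero if its restrictions to all marked simple objects are. -/
theorem eq_zero_of_comp_eq_zero {x y : H.carrier} (g : x ⟶ y)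
    (hg : ∀ (i : H.ι) (p : H.e i ⟶ x), p ≫ g = 0) : g = 0 := by
  induction hn : Module.finrank ℂ (x ⟶ x) using Nat.strong_induction_on generalizing x with
  | _ n ih =>
  subst hn
  rcases lt_trichotomy (Module.finrank ℂ (x ⟶ x)) 1 with h | h | h
  · have h0 : Subsingleton (x ⟶ x) := Module.finrank_zero_iff.1 (Nat.lt_one_iff.1 h)
    rw [← Category.id_comp g, Subsingleton.elim (𝟙 x) 0, zero_comp]
  · obtain ⟨i, ⟨φ⟩, -⟩ := H.existsUnique_iso x h
    rw [← cancel_epi φ.inv, hg i φ.inv, comp_zero]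
  -- An idempotent other than the identity splits through an object with a smaller endomorphism
  -- algebra, where the induction applies. Both p and 𝟙 x - p qualify.
  · have key (q : x ⟶ x) (hq : q ≫ q = q) (hq1 : q ≠ 𝟙 x) : q ≫ g = 0 := by
      obtain ⟨y, i, r, hir, hri⟩ :=
        (IsTwoHilbert.isIdempotentComplete (H := H.carrier)).idempotents_split x q hq
      have h1 := ih _ (finrank_end_lt_of_split i r hir (hri ▸ hq1)) (i ≫ g)
        (fun j p => by rw [← Category.assoc, hg]) rfl
      rw [← hri, Category.assoc, h1, comp_zero]
    obtain ⟨p, hp, hp0, hp1⟩ := exists_idempotent h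
    have h1 := key p hp hp1
    have h2 := key (𝟙 x - p) (Idempotents.idem_of_id_sub_idem p hp)
      (fun h => hp0 (by simpa using h))
    rw [Preadditive.sub_comp, h1, sub_zero, Category.id_comp] at h2
    exact h2

variable {H}

theorem id_ne_zero (i : H.ι) : 𝟙 (H.e i) ≠ 0 := fun h => by
  have h1 := (H.scale i).2
  simp [scale, h] at h1

theorem inner_id_id (i : H.ι) : inner ℂ (𝟙 (H.e i)) (𝟙 (H.e i)) = ((H.scale i : ℝ) : ℂ) := by
  rw [← inner_self_ofReal_re (𝕜 := ℂ)]
  rfl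

theorem scale_ne_zero (i : H.ι) : ((H.scale i : ℝ) : ℂ) ≠ 0 :=
  Complex.ofReal_ne_zero.2 (H.scale i).2.ne'

/-- The scalar by which an endomorphism of a marked simple object acts. -/
def coef {i : H.ι} : (H.e i ⟶ H.e i) →ₗ[ℂ] ℂ :=
  ((H.scale i : ℝ) : ℂ)⁻¹ • (innerₛₗ ℂ (𝟙 (H.e i)))

theorem coef_apply {i : H.ι} (f : H.e i ⟶ H.e i) :
    coef f = ((H.scale i : ℝ) : ℂ)⁻¹ * inner ℂ (𝟙 (H.e i)) f := rfl

theorem coef_id (i : H.ι) : coef (𝟙 (H.e i)) = 1 := by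
  rw [coef_apply, inner_id_id, inv_mul_cancel₀ (scale_ne_zero i)]

theorem coef_smul_id {i : H.ι} (f : H.e i ⟶ H.e i) : coef f • 𝟙 (H.e i) = f := by
  obtain ⟨c, rfl⟩ := (finrank_eq_one_iff_of_nonzero' (𝟙 (H.e i)) (id_ne_zero i)).1 (H.isSimple i) f
  rw [map_smul, coef_id, smul_eq_mul, mul_one]

/-- The composite is a multiple of the identity. Pairing it with the identity and moving `dag g`
across the inner product reads off the multiple. -/
theorem comp_dag_eq {i : H.ι} {x : H.carrier} (f g : H.e i ⟶ x) :
    f ≫ dag g = (((H.scale i : ℝ) : ℂ)⁻¹ * inner ℂ g f) • 𝟙 (H.e i) := by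
  rw [← coef_smul_id (f ≫ dag g), coef_apply, ← inner_comp_left, Category.id_comp]

/-- There are no nonzero morphisms between different marked simple objects. -/
theorem hom_eq_zero {i j : H.ι} (h : i ≠ j) (f : H.e i ⟶ H.e j) : f = 0 := by
  by_contra hf
  apply h
  -- Both composites of f with `dag f` are nonzero multiples of identities, so f is invertible.
  -- Uniqueness of the marked representative then forces i = j.
  have h1 := comp_dag_eq f f
  have h2 := comp_dag_eq (dag f) (dag f)
  rw [dag_dag] at h2
  have hf' : dag f ≠ 0 := fun h0 => hf (by rw [← dag_dag f, h0, dag_zero])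
  have hc : ((H.scale i : ℝ) : ℂ)⁻¹ * inner ℂ f f ≠ 0 :=
    mul_ne_zero (inv_ne_zero (scale_ne_zero i)) (inner_self_ne_zero.2 hf)
  have hd : ((H.scale j : ℝ) : ℂ)⁻¹ * inner ℂ (dag f) (dag f) ≠ 0 :=
    mul_ne_zero (inv_ne_zero (scale_ne_zero j)) (inner_self_ne_zero.2 hf')
  generalize ((H.scale i : ℝ) : ℂ)⁻¹ * inner ℂ f f = c at h1 hc
  generalize ((H.scale j : ℝ) : ℂ)⁻¹ * inner ℂ (dag f) (dag f) = d at h2 hd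
  have e1 : f ≫ (c⁻¹ • dag f) = 𝟙 _ := by
    rw [HStarCategory.comp_smul, h1, smul_smul, inv_mul_cancel₀ hc, one_smul]
  have e2 : (d⁻¹ • dag f) ≫ f = 𝟙 _ := by
    rw [HStarCategory.smul_comp, h2, smul_smul, inv_mul_cancel₀ hd, one_smul]
  have e3 : d⁻¹ • dag f = c⁻¹ • dag f := by
    rw [← Category.comp_id (d⁻¹ • dag f), ← e1, ← Category.assoc, e2, Category.id_comp]
  obtain ⟨k, -, hk⟩ := H.existsUnique_iso (H.e i) (H.isSimple i)
  exact (hk i ⟨Iso.refl _⟩).trans (hk j ⟨⟨f, c⁻¹ • dag f, e1, e3 ▸ e2⟩⟩).symm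

/-- The multiplicity of a marked simple object in an object. -/
def mult (i : H.ι) (x : H.carrier) : ℕ := Module.finrank ℂ (H.e i ⟶ x)

theorem mult_self (i : H.ι) : mult i (H.e i) = 1 := H.isSimple i

theorem mult_ne {i j : H.ι} (h : i ≠ j) : mult i (H.e j) = 0 :=
  Module.finrank_zero_iff.2 ⟨fun f g => (hom_eq_zero h f).trans (hom_eq_zero h g).symm⟩

/-- An orthonormal basis of `Hom(e_i, x)`. -/
def onb (i : H.ι) (x : H.carrier) : OrthonormalBasis (Fin (mult i x)) ℂ (H.e i ⟶ x) :=
  stdOrthonormalBasis ℂ (H.e i ⟶ x)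

/-- A basis of `Hom(e_i, x)` consisting of isometries. -/
def frame (i : H.ι) (x : H.carrier) (a : Fin (mult i x)) : H.e i ⟶ x :=
  -- A unit vector g satisfies g ≫ dag g = k_i⁻¹ • 𝟙 by `comp_dag_eq`; the factor √k_i turns it into
  -- an isometry.
  ((√(H.scale i : ℝ) : ℝ) : ℂ) • onb i x a

theorem sqrt_scale_sq (i : H.ι) :
    ((√(H.scale i : ℝ) : ℝ) : ℂ) * ((√(H.scale i : ℝ) : ℝ) : ℂ) = ((H.scale i : ℝ) : ℂ) := by
  rw [← Complex.ofReal_mul, Real.mul_self_sqrt (H.scale i).2.le]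

theorem frame_comp_dag (i : H.ι) (x : H.carrier) (a b : Fin (mult i x)) :
    frame i x a ≫ dag (frame i x b) = if a = b then 𝟙 (H.e i) else 0 := by
  rw [comp_dag_eq, frame, frame, inner_smul_left, inner_smul_right, Complex.conj_ofReal,
    ← mul_assoc (_ : ℂ) _ (inner ℂ _ _), sqrt_scale_sq, ← mul_assoc,
    inv_mul_cancel₀ (scale_ne_zero i), one_mul, OrthonormalBasis.inner_eq_ite]
  simp only [eq_comm, ite_smul, one_smul, zero_smul]

theorem comp_dag_of_ne {i j : H.ι} (h : i ≠ j) {x : H.carrier} (f : H.e i ⟶ x) (g : H.e j ⟶ x) :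
    f ≫ dag g = 0 := hom_eq_zero h _

/-- This is the expansion in the orthonormal basis: the two factors √k_i coming from `frame` cancel
the k_i⁻¹ of `comp_dag_eq`. -/
theorem sum_coef_smul_frame {i : H.ι} {x : H.carrier} (f : H.e i ⟶ x) :
    ∑ a, coef (f ≫ dag (frame i x a)) • frame i x a = f := by
  rw [← (onb i x).sum_repr' f]
  refine Finset.sum_congr rfl fun a _ => ?_
  rw [(onb i x).sum_repr' f, comp_dag_eq, map_smul, coef_id, frame, inner_smul_left,
    Complex.conj_ofReal, smul_smul, smul_eq_mul, mul_one]
  congr 1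
  rw [mul_comm, ← mul_assoc, ← mul_assoc, mul_right_comm (_ : ℂ) (_ : ℂ)⁻¹, sqrt_scale_sq,
    mul_inv_cancel₀ (scale_ne_zero i), one_mul]

theorem sum_comp_frame {i : H.ι} {x : H.carrier} (f : H.e i ⟶ x) :
    ∑ a, (f ≫ dag (frame i x a)) ≫ frame i x a = f := by
  conv_rhs => rw [← sum_coef_smul_frame f]
  refine Finset.sum_congr rfl fun a _ => ?_
  conv_lhs => rw [← coef_smul_id (f ≫ dag (frame i x a)), HStarCategory.smul_comp,
    Category.id_comp]

/-- The difference of the two sides is killed by every map p from a marked simple e_i: the frame at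
i expands p, and the other frames contribute zero by Schur's lemma. -/
theorem sum_dag_comp_frame (x : H.carrier) :
    ∑ i : H.ι, ∑ a, dag (frame i x a) ≫ frame i x a = 𝟙 x := by
  refine (sub_eq_zero.1 (H.eq_zero_of_comp_eq_zero _ fun i p => ?_)).symm
  rw [Preadditive.comp_sub, Category.comp_id, Preadditive.comp_sum, Finset.sum_eq_single i]
  · rw [Preadditive.comp_sum, sub_eq_zero]
    simpa using (sum_comp_frame p).symm
  · intro j _ hj
    rw [Preadditive.comp_sum]
    refine Finset.sum_eq_zero fun a _ => ?_
    rw [← Category.assoc, comp_dag_of_ne hj.symm, zero_comp]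
  · exact fun h => absurd (Finset.mem_univ i) h

end MarkedTwoHilb

/-! ### Inner products on fibres of bundles -/

namespace WSum

variable {ι : Type w} {c : ι → {r : ℝ // 0 < r}} {V : ι → Type v} [Fintype ι]
  [∀ i, NormedAddCommGroup (V i)] [∀ i, InnerProductSpace ℂ (V i)]

theorem inner_eq_sum_eval (v w : WSum c V) :
    inner ℂ v w = ∑ i, ((c i : ℝ) : ℂ) * inner ℂ (eval i v) (eval i w) := rfl

theorem inner_single_same (i : ι) (v w : V i) :
    inner ℂ (single (c := c) i v) (single (c := c) i w) = ((c i : ℝ) : ℂ) * inner ℂ v w := by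
  rw [inner_eq_sum_eval, Finset.sum_eq_single i]
  · rw [eval_single_same, eval_single_same]
  · intro j _ hj
    rw [eval_single_ne hj, inner_zero_left, mul_zero]
  · exact fun h => absurd (Finset.mem_univ i) h

theorem inner_single_of_ne {i j : ι} (h : i ≠ j) (v : V i) (w : V j) :
    inner ℂ (single (c := c) i v) (single (c := c) j w) = 0 := by
  rw [inner_eq_sum_eval]
  refine Finset.sum_eq_zero fun k _ => ?_
  by_cases hk : k = i
  · rw [eval_single_ne (i := j) (hk ▸ h), inner_zero_right, mul_zero]
  · rw [eval_single_ne hk, inner_zero_left, mul_zero]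

end WSum

namespace HilbBundle

variable {X Y Z : FinSpace.{v}}

theorem inner_tens_same (E : HilbBundle X Y) (F : HilbBundle Y Z) {z : Z} {x : X} (y : Y)
    (f f' : F.fiber z y) (e e' : E.fiber y x) :
    inner ℂ (tens (E := E) y f e) (tens y f' e') =
      ((Y.k y : ℝ) : ℂ)⁻¹ * (inner ℂ f f' * inner ℂ e e') := by
  refine (WSum.inner_single_same (c := fun y : Y => (Y.k y)⁻¹)
    (V := fun y => F.fiber z y ⊗[ℂ] E.fiber y x) y (f ⊗ₜ e) (f' ⊗ₜ e')).trans ?_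
  rw [TensorProduct.inner_tmul, Positive.coe_inv, Complex.ofReal_inv]

theorem inner_tens_of_ne (E : HilbBundle X Y) (F : HilbBundle Y Z) {z : Z} {x : X} {y y' : Y}
    (hy : y ≠ y') (f : F.fiber z y) (e : E.fiber y x) (f' : F.fiber z y') (e' : E.fiber y' x) :
    inner ℂ (tens (E := E) y f e) (tens y' f' e') = 0 :=
  WSum.inner_single_of_ne (c := fun y : Y => (Y.k y)⁻¹)
    (V := fun y => F.fiber z y ⊗[ℂ] E.fiber y x) hy (f ⊗ₜ e) (f' ⊗ₜ e')

/-- A linear map out of a fiber of a composite preserves inner products if it does so on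
homogeneous elements. -/
theorem inner_map_map_of_tens {E : HilbBundle X Y} {F : HilbBundle Y Z} {z : Z} {x : X}
    {W : Type*} [NormedAddCommGroup W] [InnerProductSpace ℂ W]
    (φ : (E.comp F).fiber z x →ₗ[ℂ] W)
    (h : ∀ y f e y' f' e', inner ℂ (φ (tens y f e)) (φ (tens y' f' e')) =
      inner ℂ (tens (E := E) (F := F) (z := z) (x := x) y f e) (tens y' f' e'))
    (v w : (E.comp F).fiber z x) : inner ℂ (φ v) (φ w) = inner ℂ v w := by
  induction v using tens_induction with
  | h0 => rw [map_zero, inner_zero_left, inner_zero_left]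
  | hadd v v' hv hv' => rw [map_add, inner_add_left, inner_add_left, hv, hv']
  | ht y f e =>
    induction w using tens_induction with
    | h0 => rw [map_zero, inner_zero_right, inner_zero_right]
    | hadd v v' hv hv' => rw [map_add, inner_add_right, inner_add_right, hv, hv']
    | ht y' f' e' => exact h y f e y' f' e'

theorem inner_one_one (x : X) :
    inner ℂ (one (X := X) x) (one x) = ((X.k x : ℝ) : ℂ) := by
  refine (WSum.inner_single_same (c := fun _ : DiagIndex x x => X.k x) (V := fun _ => ℂ)
    ⟨PUnit.unit, rfl⟩ 1 1).trans ?_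
  simp

theorem exists_eq_smul_one {x : X} (v : (id X).fiber x x) : ∃ a : ℂ, v = a • one x := by
  let u : DiagIndex x x := ⟨PUnit.unit, rfl⟩
  have hv := WSum.sum_single (c := fun _ : DiagIndex x x => X.k x) (V := fun _ => ℂ) v
  rw [Fintype.sum_eq_single u (fun u' hu => absurd (Subtype.ext rfl) hu)] at hv
  refine ⟨WSum.eval (c := fun _ : DiagIndex x x => X.k x) (V := fun _ => ℂ) u v,
    hv.symm.trans ?_⟩
  refine Eq.trans ?_ (map_smul (WSum.single (c := fun _ : DiagIndex x x => X.k x)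
    (V := fun _ => ℂ) u) _ 1)
  rw [smul_eq_mul, mul_one]

theorem eq_zero_of_ne {x y : X} (h : y ≠ x) (v : (id X).fiber y x) : v = 0 :=
  funext fun u : DiagIndex y x => absurd u.2 h

end HilbBundle

/-! ### Unitary 2-morphisms -/

section Unitary

variable {X Y : FinSpace.{v}} {E F : X ⟶ Y}

/-- For an isometry the adjoint is a left inverse; surjectivity makes it two-sided. -/
theorem LinearMap.isUnitary_of_inner_of_surjective {V W : Type*} [NormedAddCommGroup V]
    [InnerProductSpace ℂ V] [FiniteDimensional ℂ V] [NormedAddCommGroup W]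
    [InnerProductSpace ℂ W] [FiniteDimensional ℂ W] (φ : V →ₗ[ℂ] W)
    (h : ∀ v w, inner ℂ (φ v) (φ w) = inner ℂ v w) (hs : Function.Surjective φ) :
    LinearMap.adjoint φ ∘ₗ φ = LinearMap.id ∧ φ ∘ₗ LinearMap.adjoint φ = LinearMap.id := by
  have h1 : LinearMap.adjoint φ ∘ₗ φ = LinearMap.id := by
    refine LinearMap.ext fun v => ext_inner_right ℂ fun w => ?_
    rw [LinearMap.comp_apply, LinearMap.adjoint_inner_left, h, LinearMap.id_apply]
  refine ⟨h1, LinearMap.ext fun w => ?_⟩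
  obtain ⟨v, rfl⟩ := hs w
  exact congrArg φ (LinearMap.congr_fun h1 v)

/-- A unitary 2-morphism of finite spaces is invertible. -/
def IsUnitaryCell.iso {f : E ⟶ F} (hf : IsUnitaryCell f) : E ≅ F where
  hom := f
  inv := ⟨fun y x => LinearMap.adjoint (f.app y x)⟩
  hom_inv_id := HilbBundle.hom_ext fun y x => (hf y x).1
  inv_hom_id := HilbBundle.hom_ext fun y x => (hf y x).2

end Unitary

/-! ### Unitarity of the coherence cells and the weak 2-functor -/

namespace MarkedTwoHilb

open HStarCategory

variable {H K L : MarkedTwoHilb.{v, u}}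

/-- As G preserves `dag`, the map `G.map f` moves across the inner product and merges with `G.map
f'`. Only the morphism f' ≫ dag f between marked simples then matters. -/
theorem inner_comp_map (G : K ⟶ L) {x : K.carrier} {z : L.carrier} {μ ν : K.ι}
    (g : z ⟶ G.obj (K.e μ)) (f : K.e μ ⟶ x) (g' : z ⟶ G.obj (K.e ν)) (f' : K.e ν ⟶ x) :
    inner ℂ (g ≫ G.map f) (g' ≫ G.map f') = inner ℂ g (g' ≫ G.map (f' ≫ dag f)) := by
  rw [inner_comp_left, Category.assoc, ← G.map_dag', ← G.map_comp]

/-- Schur's lemma replaces f' ≫ dag f by (f, f')/k_μ. This is the source of the weight 1/k_μ in the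
composition of bundles. -/
theorem inner_comp_map_same (G : K ⟶ L) {x : K.carrier} {z : L.carrier} {μ : K.ι}
    (g g' : z ⟶ G.obj (K.e μ)) (f f' : K.e μ ⟶ x) :
    inner ℂ (g ≫ G.map f) (g' ≫ G.map f') =
      ((K.scale μ : ℝ) : ℂ)⁻¹ * (inner ℂ g g' * inner ℂ f f') := by
  rw [inner_comp_map, comp_dag_eq, G.map_smul', G.map_id, HStarCategory.comp_smul,
    Category.comp_id, inner_smul_right, mul_assoc, mul_comm (inner ℂ f f')]

theorem _root_.StarFunctor.map_zero' {H : Type u} [Category.{v} H] [HStarCategory H]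
    {K : Type u'} [Category.{v} K] [HStarCategory K] (F : StarFunctor H K) (x y : H) :
    F.map (0 : x ⟶ y) = 0 := by
  simpa using F.map_smul' 0 (0 : x ⟶ y)

theorem _root_.StarFunctor.map_sum' {H : Type u} [Category.{v} H] [HStarCategory H]
    {K : Type u'} [Category.{v} K] [HStarCategory K] (F : StarFunctor H K) {x y : H}
    {J : Type*} (s : Finset J) (f : J → (x ⟶ y)) :
    F.map (∑ j ∈ s, f j) = ∑ j ∈ s, F.map (f j) := by
  classical
  induction s using Finset.induction_on with
  | empty => simpa using F.map_zero' x y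
  | insert a s ha ih => rw [Finset.sum_insert ha, Finset.sum_insert ha, F.map_add', ih]

theorem inner_comp_map_of_ne (G : K ⟶ L) {x : K.carrier} {z : L.carrier} {μ ν : K.ι} (h : μ ≠ ν)
    (g : z ⟶ G.obj (K.e μ)) (f : K.e μ ⟶ x) (g' : z ⟶ G.obj (K.e ν)) (f' : K.e ν ⟶ x) :
    inner ℂ (g ≫ G.map f) (g' ≫ G.map f') = 0 := by
  rw [inner_comp_map, comp_dag_of_ne h.symm, StarFunctor.map_zero', comp_zero, inner_zero_right]

/-- G is applied to the resolution of the identity of x. With x = F e_i the summands exhibit a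
preimage of h under the compositor. -/
theorem sum_comp_map_frame (G : K ⟶ L) {x : K.carrier} {z : L.carrier} (h : z ⟶ G.obj x) :
    ∑ μ : K.ι, ∑ a, (h ≫ G.map (dag (frame μ x a))) ≫ G.map (frame μ x a) = h := by
  simp only [Category.assoc, ← G.map_comp]
  simp only [← Preadditive.comp_sum, ← StarFunctor.map_sum']
  rw [sum_dag_comp_frame, G.map_id, Category.comp_id]

theorem isUnitaryCell_compositor (F : H ⟶ K) (G : K ⟶ L) : IsUnitaryCell (compositor F G) := by
  intro l i
  refine LinearMap.isUnitary_of_inner_of_surjective _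
    (HilbBundle.inner_map_map_of_tens (E := bundle F) (F := bundle G) _ ?_) ?_
  · intro μ g f ν g' f'
    have h1 := compositor_tens F G l i μ g f
    have h2 := compositor_tens F G l i ν g' f'
    refine (congrArg₂ (inner ℂ) h1 h2).trans ?_
    by_cases h : μ = ν
    · subst h
      exact (inner_comp_map_same G g g' f f').trans
        (HilbBundle.inner_tens_same (bundle F) (bundle G) (z := l) (x := i) μ g g' f f').symm
    · exact (inner_comp_map_of_ne G h g f g' f').trans
        (HilbBundle.inner_tens_of_ne (bundle F) (bundle G) (z := l) (x := i) h g f g' f').symm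
  · intro (h : L.e l ⟶ G.obj (F.obj (H.e i)))
    refine ⟨∑ μ : K.ι, ∑ a, HilbBundle.tens (E := bundle F) (F := bundle G) (z := l) (x := i) μ
      (h ≫ G.map (dag (frame μ (F.obj (H.e i)) a)) : L.e l ⟶ G.obj (K.e μ))
      (frame μ (F.obj (H.e i)) a), ?_⟩
    refine (map_sum _ _ _).trans (Eq.trans (Finset.sum_congr rfl fun μ _ => (map_sum _ _ _).trans
      (Finset.sum_congr rfl fun a _ => ?_)) (sum_comp_map_frame G h))
    exact compositor_tens F G l i μ _ _

/-- On the diagonal both fibres are lines, whose generators 1 and 𝟙 have the same squared norm k_j.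
Off the diagonal both fibres are zero, the target by Schur's lemma. -/
theorem isUnitaryCell_unitor (H : MarkedTwoHilb.{v, u}) : IsUnitaryCell (unitor H) := by
  intro j i
  refine LinearMap.isUnitary_of_inner_of_surjective _ (fun v w => ?_) (fun f => ?_)
  · by_cases h : j = i
    · subst h
      obtain ⟨a, rfl⟩ := HilbBundle.exists_eq_smul_one (X := H.space) v
      obtain ⟨b, rfl⟩ := HilbBundle.exists_eq_smul_one (X := H.space) w
      rw [map_smul, map_smul, inner_smul_left, inner_smul_right, inner_smul_left,
        inner_smul_right]
      congr 2
      exact (congrArg₂ (inner ℂ) (unitor_one H j) (unitor_one H j)).trans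
        ((inner_id_id j).trans (HilbBundle.inner_one_one (X := H.space) j).symm)
    · rw [HilbBundle.eq_zero_of_ne (X := H.space) h v, map_zero, inner_zero_left, inner_zero_left]
  · change H.e j ⟶ H.e i at f
    by_cases h : j = i
    · subst h
      refine ⟨coef f • HilbBundle.one (X := H.space) j, ?_⟩
      exact (map_smul _ _ _).trans ((congrArg (coef f • ·) (unitor_one H j)).trans (coef_smul_id f))
    · exact ⟨0, (map_zero _).trans (hom_eq_zero h f).symm⟩

/-- The 2-functor `⟨·⟩`. -/
def bracketPseudo : Pseudofunctor MarkedTwoHilb.{v, u} FinSpace.{v} :=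
  -- The coherence laws are part of `bracket`, so only inverses of its coherence cells are needed. A
  -- pseudofunctor records these cells in the opposite direction, hence `symm`.
  Pseudofunctor.mkOfLax bracket
    { mapIdIso := fun H => (isUnitaryCell_unitor H).iso.symm
      mapCompIso := fun F G => (isUnitaryCell_compositor F G).iso.symm
      mapIdIso_inv := rfl
      mapCompIso_inv := fun _ _ => rfl }

theorem bracketPseudo_toLax : bracketPseudo.{v, u}.toLax = bracket := rfl

end MarkedTwoHilb

/-! ### Natural transformations as maps of bundles, and their inner products -/

namespace MarkedTwoHilb

open HStarCategory

variable {H K : MarkedTwoHilb.{v, u}}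

theorem coef_dag {i : H.ι} (f : H.e i ⟶ H.e i) : coef (dag f) = starRingEnd ℂ (coef f) := by
  conv_lhs => rw [← coef_smul_id f, dag_smul, dag_id, map_smul, coef_id, smul_eq_mul, mul_one]

theorem sum_coef_smul_dag_frame {i : H.ι} {x : H.carrier} (h : x ⟶ H.e i) :
    ∑ a, coef (frame i x a ≫ h) • dag (frame i x a) = h := by
  have := congrArg dag (sum_coef_smul_frame (dag h))
  rw [dag_dag, dag_sum] at this
  refine Eq.trans (Finset.sum_congr rfl fun a _ => ?_) this
  rw [dag_smul, ← dag_comp, coef_dag, Complex.conj_conj]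

variable {F G : H ⟶ K}

/-- The natural transformation with prescribed components at the marked simple objects. -/
def natOfComponents (t : ∀ i, F.obj (H.e i) ⟶ G.obj (H.e i)) : F ⟶ G where
  nat :=
  -- Naturality and the resolution of the identity of x force this formula; compare
  -- `natOfComponents_app_self`.
  { app x := ∑ i, ∑ a, F.map (dag (frame i x a)) ≫ t i ≫ G.map (frame i x a)
    naturality x y f := by
      rw [Preadditive.comp_sum, Preadditive.sum_comp]
      refine Finset.sum_congr rfl fun i _ => ?_
      rw [Preadditive.comp_sum, Preadditive.sum_comp]
      -- Expanding f ≫ dag (frame i y c) over x, and frame i x a ≫ f over y, produces the same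
      -- scalars: the matrix entries of f. The two double sums differ only in order.
      have h1 (c) : F.map f ≫ F.map (dag (frame i y c)) ≫ t i ≫ G.map (frame i y c) =
          ∑ a, coef (frame i x a ≫ f ≫ dag (frame i y c)) •
            F.map (dag (frame i x a)) ≫ t i ≫ G.map (frame i y c) := by
        rw [← F.map_comp_assoc, ← sum_coef_smul_dag_frame (f ≫ dag (frame i y c)),
          StarFunctor.map_sum', Preadditive.sum_comp]
        refine Finset.sum_congr rfl fun a _ => ?_
        rw [F.map_smul', HStarCategory.smul_comp, sum_coef_smul_dag_frame]
      have h2 (a) : (F.map (dag (frame i x a)) ≫ t i ≫ G.map (frame i x a)) ≫ G.map f =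
          ∑ c, coef (frame i x a ≫ f ≫ dag (frame i y c)) •
            F.map (dag (frame i x a)) ≫ t i ≫ G.map (frame i y c) := by
        rw [Category.assoc, Category.assoc, ← G.map_comp,
          ← sum_coef_smul_frame (frame i x a ≫ f), StarFunctor.map_sum', Preadditive.comp_sum,
          Preadditive.comp_sum]
        refine Finset.sum_congr rfl fun c _ => ?_
        rw [G.map_smul', HStarCategory.comp_smul, HStarCategory.comp_smul, Category.assoc]
      refine (Finset.sum_congr rfl fun c _ => h1 c).trans (Finset.sum_comm.trans
        (Finset.sum_congr rfl fun a _ => (h2 a).symm)) }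

theorem natOfComponents_app (t : ∀ i, F.obj (H.e i) ⟶ G.obj (H.e i)) (x : H.carrier) :
    (natOfComponents t).nat.app x =
      ∑ i, ∑ a, F.map (dag (frame i x a)) ≫ t i ≫ G.map (frame i x a) := rfl

/-- Endomorphisms of e_j are scalars, so t j intertwines their images under F and G. Both frame
factors then collect under F into the resolution of the identity of e_j, where only the index j
contributes. -/
theorem natOfComponents_app_e (t : ∀ i, F.obj (H.e i) ⟶ G.obj (H.e i)) (j : H.ι) :
    (natOfComponents t).nat.app (H.e j) = t j := by
  have hscalar (f : H.e j ⟶ H.e j) : t j ≫ G.map f = F.map f ≫ t j := by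
    rw [← coef_smul_id f, G.map_smul', F.map_smul', G.map_id, F.map_id, HStarCategory.comp_smul,
      HStarCategory.smul_comp, Category.id_comp, Category.comp_id]
  have hne (i : H.ι) (hi : i ≠ j) (a) : frame i (H.e j) a = 0 := hom_eq_zero hi _
  have hid := sum_dag_comp_frame (H.e j)
  rw [natOfComponents_app, Finset.sum_eq_single j]
  · rw [Finset.sum_eq_single j] at hid
    · simp only [hscalar, ← F.map_comp_assoc]
      rw [← Preadditive.sum_comp, ← StarFunctor.map_sum', hid, F.map_id, Category.id_comp]
    · intro i _ hi
      exact Finset.sum_eq_zero fun a _ => by rw [hne i hi a, comp_zero]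
    · exact fun h => absurd (Finset.mem_univ j) h
  · intro i _ hi
    exact Finset.sum_eq_zero fun a _ => by
      rw [hne i hi a, StarFunctor.map_zero', comp_zero, comp_zero]
  · exact fun h => absurd (Finset.mem_univ j) h

theorem natOfComponents_app_self (θ : F ⟶ G) :
    natOfComponents (fun i => θ.nat.app (H.e i)) = θ := by
  refine StarFunctor.Hom.ext (NatTrans.ext (funext fun x => ?_))
  rw [natOfComponents_app]
  simp only [← θ.nat.naturality, ← F.map_comp_assoc]
  simp only [← Preadditive.sum_comp, ← StarFunctor.map_sum']
  rw [sum_dag_comp_frame, F.map_id, Category.id_comp]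

/-- The morphism inducing given linear maps by postcomposition. -/
def ofPost {x y : H.carrier} (φ : ∀ i : H.ι, (H.e i ⟶ x) →ₗ[ℂ] (H.e i ⟶ y)) : x ⟶ y :=
  ∑ i, ∑ a, dag (frame i x a) ≫ φ i (frame i x a)

theorem comp_ofPost {x y : H.carrier} (φ : ∀ i : H.ι, (H.e i ⟶ x) →ₗ[ℂ] (H.e i ⟶ y)) {i : H.ι}
    (f : H.e i ⟶ x) : f ≫ ofPost φ = φ i f := by
  rw [ofPost, Preadditive.comp_sum, Finset.sum_eq_single i]
  · rw [Preadditive.comp_sum]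
    conv_rhs => rw [← sum_coef_smul_frame f, map_sum]
    refine Finset.sum_congr rfl fun a _ => ?_
    rw [← Category.assoc, map_smul]
    conv_lhs => rw [← coef_smul_id (f ≫ _), HStarCategory.smul_comp, Category.id_comp]
  · intro j _ hj
    rw [Preadditive.comp_sum]
    refine Finset.sum_eq_zero fun a _ => ?_
    rw [← Category.assoc, comp_dag_of_ne hj.symm, zero_comp]
  · exact fun h => absurd (Finset.mem_univ i) h

theorem ofPost_comp {x y : H.carrier} (f : x ⟶ y) :
    ofPost (fun i => StarFunctor.post (H.e i) f) = f := by
  change ∑ i, ∑ a, dag (frame i x a) ≫ frame i x a ≫ f = f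
  simp only [← Category.assoc, ← Preadditive.sum_comp]
  rw [sum_dag_comp_frame, Category.id_comp]

variable (F G) in
/-- Natural transformations correspond linearly to maps of bundles. -/
def bundleMapEquiv : (F ⟶ G) ≃ₗ[ℂ] (bundle F ⟶ bundle G) where
  toFun θ := bundleMap θ
  map_add' θ θ' := HilbBundle.hom_ext fun μ i => LinearMap.ext fun f =>
    HStarCategory.comp_add f (θ.nat.app (H.e i)) (θ'.nat.app (H.e i))
  map_smul' c θ := HilbBundle.hom_ext fun μ i => LinearMap.ext fun f =>
    HStarCategory.comp_smul f c (θ.nat.app (H.e i))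
  invFun φ := natOfComponents fun i => ofPost fun μ => φ.app μ i
  left_inv θ := by
    refine Eq.trans ?_ (natOfComponents_app_self θ)
    exact congrArg natOfComponents (funext fun i => ofPost_comp (θ.nat.app (H.e i)))
  right_inv φ := HilbBundle.hom_ext fun μ i => LinearMap.ext fun (f : K.e μ ⟶ F.obj (H.e i)) =>
    (congrArg (f ≫ ·) (natOfComponents_app_e (F := F) (G := G)
      (fun i => ofPost fun μ => φ.app μ i) i)).trans (comp_ofPost (fun μ => φ.app μ i) f)

/-- The weight k_μ converts the orthonormal basis that computes the trace into the frame p. Each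
term (p ≫ f, p ≫ g) equals (f, dag p ≫ p ≫ g), and these sum to (f, g) by the resolution of the
identity. -/
theorem sum_scale_mul_trace {x y : K.carrier} (f g : x ⟶ y) :
    ∑ μ : K.ι, ((K.scale μ : ℝ) : ℂ) * LinearMap.trace ℂ _
      (LinearMap.adjoint (StarFunctor.post (K.e μ) f) ∘ₗ StarFunctor.post (K.e μ) g) =
      inner ℂ f g := by
  have h (μ : K.ι) : ((K.scale μ : ℝ) : ℂ) * LinearMap.trace ℂ _
      (LinearMap.adjoint (StarFunctor.post (K.e μ) f) ∘ₗ StarFunctor.post (K.e μ) g) =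
      ∑ a, inner ℂ f ((dag (frame μ x a) ≫ frame μ x a) ≫ g) := by
    rw [LinearMap.trace_eq_sum_inner _ (onb μ x), Finset.mul_sum]
    refine Finset.sum_congr rfl fun a _ => ?_
    rw [LinearMap.comp_apply, LinearMap.adjoint_inner_right, Category.assoc, ← inner_comp_right,
      frame, HStarCategory.smul_comp, HStarCategory.smul_comp, inner_smul_left, inner_smul_right,
      Complex.conj_ofReal, ← mul_assoc, sqrt_scale_sq]
    rfl
  simp only [h, ← inner_sum, ← Preadditive.sum_comp]
  rw [sum_dag_comp_frame, Category.id_comp]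

theorem bundleInner_bundleMap (θ θ' : F ⟶ G) :
    bundleInner (bundleMap θ) (bundleMap θ') = natInner θ θ' := by
  refine Finset.sum_congr rfl fun i _ => ?_
  refine Eq.trans ?_ (congrArg (((H.scale i : ℝ) : ℂ) * ·)
    (sum_scale_mul_trace (θ.nat.app (H.e i)) (θ'.nat.app (H.e i))))
  refine Eq.trans (Finset.sum_congr rfl fun μ _ => ?_) (Finset.mul_sum _ _ _).symm
  exact mul_assoc _ _ _

end MarkedTwoHilb

/-! ### Functors with prescribed multiplicities -/

namespace MarkedTwoHilb

open HStarCategory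

variable {H K : MarkedTwoHilb.{v, u}}

open Classical in
theorem mult_eq_ite (i j : H.ι) : mult i (H.e j) = if i = j then 1 else 0 := by
  split_ifs with h
  · rw [h, mult_self]
  · exact mult_ne h

/-- There is an object with prescribed multiplicities. -/
theorem exists_mult_eq (n : H.ι → ℕ) : ∃ x : H.carrier, ∀ i, mult i x = n i := by
  classical
  have := IsTwoHilbert.hasFiniteBiproducts (H := H.carrier)
  let f : (Σ i, Fin (n i)) → H.carrier := fun s => H.e s.1
  refine ⟨⨁ f, fun i => ?_⟩
  let φ : (H.e i ⟶ ⨁ f) ≃ₗ[ℂ] (∀ s, H.e i ⟶ f s) :=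
    { toFun g s := g ≫ biproduct.π f s
      map_add' g h := funext fun s => HStarCategory.add_comp g h _
      map_smul' c g := funext fun s => HStarCategory.smul_comp c g _
      invFun g := biproduct.lift g
      left_inv g := biproduct.hom_ext _ _ fun s => biproduct.lift_π _ _
      right_inv g := funext fun s => biproduct.lift_π _ _ }
  rw [mult, φ.finrank_eq, Module.finrank_pi_fintype]
  refine (Finset.sum_congr rfl fun s _ => mult_eq_ite i s.1).trans ?_
  rw [Fintype.sum_sigma, Finset.sum_eq_single i]
  · simp
  · intro j _ hj
    simp [hj.symm]
  · exact fun h => absurd (Finset.mem_univ i) h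

/-- There is an object which is an orthogonal direct sum of prescribed families of copies of the
marked simple objects. -/
theorem exists_orthogonal_sum (J : H.ι → Type*) [∀ i, Fintype (J i)] [∀ i, DecidableEq (J i)] :
    ∃ (x : H.carrier) (c : ∀ i, J i → (H.e i ⟶ x)),
      (∀ i a b, c i a ≫ dag (c i b) = if a = b then 𝟙 (H.e i) else 0) ∧
      (∑ i, ∑ a, dag (c i a) ≫ c i a = 𝟙 x) ∧ ∀ i, mult i x = Fintype.card (J i) := by
  -- The legs of a categorical biproduct need not be isometric. Only its multiplicities are used;
  -- orthogonal legs are then supplied by frames.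
  obtain ⟨x, hx⟩ := exists_mult_eq (H := H) fun i => Fintype.card (J i)
  let eqv : ∀ i, J i ≃ Fin (mult i x) := fun i => (Fintype.equivFin _).trans (finCongr (hx i).symm)
  refine ⟨x, fun i a => frame i x (eqv i a), fun i a b => ?_, ?_, hx⟩
  · rw [frame_comp_dag]
    simp only [(eqv i).injective.eq_iff]
  · rw [← sum_dag_comp_frame x]
    exact Finset.sum_congr rfl fun i _ => (eqv i).sum_comp fun a => dag (frame i x a) ≫ frame i x a

/-- The matrix entries of a morphism. -/
def entry {x y : H.carrier} (f : x ⟶ y) (i : H.ι) (a : Fin (mult i x)) (b : Fin (mult i y)) : ℂ :=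
  coef (frame i x a ≫ f ≫ dag (frame i y b))

theorem entry_add {x y : H.carrier} (f g : x ⟶ y) (i : H.ι) (a : Fin (mult i x))
    (b : Fin (mult i y)) : entry (f + g) i a b = entry f i a b + entry g i a b := by
  rw [entry, HStarCategory.add_comp, HStarCategory.comp_add, map_add]
  rfl

theorem entry_smul {x y : H.carrier} (c : ℂ) (f : x ⟶ y) (i : H.ι) (a : Fin (mult i x))
    (b : Fin (mult i y)) : entry (c • f) i a b = c * entry f i a b := by
  rw [entry, HStarCategory.smul_comp, HStarCategory.comp_smul, map_smul]
  rfl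

theorem entry_dag {x y : H.carrier} (f : x ⟶ y) (i : H.ι) (a : Fin (mult i x))
    (b : Fin (mult i y)) : entry (dag f) i b a = starRingEnd ℂ (entry f i a b) := by
  rw [entry, entry, ← coef_dag, dag_comp, dag_comp, dag_dag, Category.assoc]

theorem entry_id (x : H.carrier) (i : H.ι) (a b : Fin (mult i x)) :
    entry (𝟙 x) i a b = if a = b then 1 else 0 := by
  rw [entry, Category.id_comp, frame_comp_dag, apply_ite coef, coef_id, map_zero]

theorem entry_comp {x y z : H.carrier} (f : x ⟶ y) (g : y ⟶ z) (i : H.ι) (a : Fin (mult i x))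
    (c : Fin (mult i z)) : entry (f ≫ g) i a c = ∑ b, entry f i a b * entry g i b c := by
  rw [entry, Category.assoc, ← Category.assoc, ← sum_coef_smul_frame (frame i x a ≫ f),
    Preadditive.sum_comp, map_sum]
  refine Finset.sum_congr rfl fun b _ => ?_
  rw [HStarCategory.smul_comp, map_smul, Category.assoc]
  rfl

section OfMultiplicities

variable (d : K.ι → H.ι → ℕ)

/-- The copies of `e_μ` in the image of `x` under the functor with multiplicities `d`. -/
abbrev CopyIndex (x : H.carrier) (μ : K.ι) : Type v := Σ i : H.ι, Fin (mult i x) × Fin (d μ i)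

open Classical in
/-- The image of an object under the functor with multiplicities `d`. -/
def sumObj (x : H.carrier) : K.carrier := (exists_orthogonal_sum (CopyIndex d x)).choose

open Classical in
/-- The isometric inclusions of the simple summands. -/
def sumLeg (x : H.carrier) (μ : K.ι) : CopyIndex d x μ → (K.e μ ⟶ sumObj d x) :=
  (exists_orthogonal_sum (CopyIndex d x)).choose_spec.choose μ

open Classical in
theorem sumLeg_comp_dag (x : H.carrier) (μ : K.ι) (s t : CopyIndex d x μ) :
    sumLeg d x μ s ≫ dag (sumLeg d x μ t) = if s = t then 𝟙 (K.e μ) else 0 :=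
  (exists_orthogonal_sum (CopyIndex d x)).choose_spec.choose_spec.1 μ s t

theorem sum_dag_comp_sumLeg (x : H.carrier) :
    ∑ μ, ∑ s, dag (sumLeg d x μ s) ≫ sumLeg d x μ s = 𝟙 (sumObj d x) := by
  classical
  exact (exists_orthogonal_sum (CopyIndex d x)).choose_spec.choose_spec.2.1

theorem mult_sumObj (x : H.carrier) (μ : K.ι) :
    mult μ (sumObj d x) = ∑ i, mult i x * d μ i := by
  classical
  refine ((exists_orthogonal_sum (CopyIndex d x)).choose_spec.choose_spec.2.2 μ).trans ?_
  simp

theorem sumObj_hom_ext {x : H.carrier} {z : K.carrier} {f g : sumObj d x ⟶ z}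
    (h : ∀ μ s, sumLeg d x μ s ≫ f = sumLeg d x μ s ≫ g) : f = g := by
  rw [← Category.id_comp f, ← Category.id_comp g, ← sum_dag_comp_sumLeg]
  simp only [Preadditive.sum_comp, Category.assoc, h]

theorem sumObj_hom_ext' {x : H.carrier} {z : K.carrier} {f g : z ⟶ sumObj d x}
    (h : ∀ μ s, f ≫ dag (sumLeg d x μ s) = g ≫ dag (sumLeg d x μ s)) : f = g := by
  rw [← Category.comp_id f, ← Category.comp_id g, ← sum_dag_comp_sumLeg]
  simp only [Preadditive.comp_sum, ← Category.assoc, h]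

/-- The image of a morphism under the functor with multiplicities `d`. -/
def sumMap {x y : H.carrier} (f : x ⟶ y) : sumObj d x ⟶ sumObj (K := K) d y :=
  -- On the part of type i this is the matrix of f tensored with the identity of the multiplicity
  -- space: the index `s.2.2` is carried along unchanged.
  ∑ μ, ∑ s : CopyIndex d x μ, ∑ b, entry f s.1 s.2.1 b •
    (dag (sumLeg d x μ s) ≫ sumLeg d y μ ⟨s.1, b, s.2.2⟩)

theorem sumLeg_comp_sumMap {x y : H.carrier} (f : x ⟶ y) (μ : K.ι) (s : CopyIndex d x μ) :
    sumLeg d x μ s ≫ sumMap d f =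
      ∑ b, entry f s.1 s.2.1 b • sumLeg d y μ ⟨s.1, b, s.2.2⟩ := by
  classical
  rw [sumMap, Preadditive.comp_sum, Finset.sum_eq_single μ]
  · rw [Preadditive.comp_sum, Finset.sum_eq_single s]
    · rw [Preadditive.comp_sum]
      refine Finset.sum_congr rfl fun b _ => ?_
      rw [HStarCategory.comp_smul, ← Category.assoc, sumLeg_comp_dag, if_pos rfl,
        Category.id_comp]
    · intro t _ ht
      rw [Preadditive.comp_sum]
      refine Finset.sum_eq_zero fun b _ => ?_
      rw [HStarCategory.comp_smul, ← Category.assoc, sumLeg_comp_dag, if_neg ht.symm, zero_comp,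
        smul_zero]
    · exact fun h => absurd (Finset.mem_univ s) h
  · intro ν _ hν
    rw [Preadditive.comp_sum]
    refine Finset.sum_eq_zero fun t _ => ?_
    rw [Preadditive.comp_sum]
    refine Finset.sum_eq_zero fun b _ => ?_
    rw [HStarCategory.comp_smul, ← Category.assoc, comp_dag_of_ne hν.symm, zero_comp, smul_zero]
  · exact fun h => absurd (Finset.mem_univ μ) h

/-- In orthonormal legs `dag` is conjugate transposition of matrix entries. This is why the direct
sums have to be orthogonal. -/
theorem sumMap_dag {x y : H.carrier} (f : x ⟶ y) :
    sumMap (K := K) d (dag f) = dag (sumMap d f) := by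
  classical
  refine sumObj_hom_ext d fun μ s => sumObj_hom_ext' d fun ν t => ?_
  by_cases hμ : μ = ν
  · subst hμ
    have h : sumLeg d y μ s ≫ dag (sumMap d f) = dag (sumMap d f ≫ dag (sumLeg d y μ s)) := by
      rw [dag_comp, dag_dag]
    rw [h, ← dag_comp, ← Category.assoc, sumLeg_comp_sumMap, sumLeg_comp_sumMap,
      Preadditive.sum_comp, Preadditive.sum_comp, dag_sum]
    simp only [HStarCategory.smul_comp, sumLeg_comp_dag, dag_smul, apply_ite dag, dag_id, dag_zero]
    obtain ⟨i, b, m⟩ := s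
    obtain ⟨j, a, n⟩ := t
    by_cases hij : i = j
    · subst hij
      by_cases hmn : m = n
      · subst hmn
        simp [entry_dag]
      · simp [hmn, Ne.symm hmn]
    · simp [hij, Ne.symm hij]
  · rw [comp_dag_of_ne hμ, comp_dag_of_ne hμ]

/-- The `*`-functor with multiplicities `d`. -/
def ofMultiplicities : H ⟶ K where
  obj := sumObj d
  map := sumMap d
  map_id x := sumObj_hom_ext d fun μ s => by
    rw [sumLeg_comp_sumMap, Category.comp_id]
    simp [entry_id]
  map_comp f g := sumObj_hom_ext d fun μ s => by
    rw [← Category.assoc, sumLeg_comp_sumMap, sumLeg_comp_sumMap, Preadditive.sum_comp]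
    simp only [HStarCategory.smul_comp, sumLeg_comp_sumMap, entry_comp, Finset.smul_sum,
      Finset.sum_smul, smul_smul]
    exact Finset.sum_comm
  map_add' f g := sumObj_hom_ext d fun μ s => by
    simp only [HStarCategory.comp_add, sumLeg_comp_sumMap, entry_add, add_smul,
      Finset.sum_add_distrib]
  map_smul' c f := sumObj_hom_ext d fun μ s => by
    simp only [HStarCategory.comp_smul, sumLeg_comp_sumMap, entry_smul, mul_smul, Finset.smul_sum]
  map_dag' f := sumMap_dag d f

theorem finrank_ofMultiplicities (μ : K.ι) (i : H.ι) :
    Module.finrank ℂ (K.e μ ⟶ (ofMultiplicities d).obj (H.e i)) = d μ i := by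
  classical
  refine (mult_sumObj d (H.e i) μ).trans ?_
  simp [mult_eq_ite]

end OfMultiplicities

/-- Bundles with linearly isomorphic fibers are isomorphic. -/
def _root_.HilbBundle.isoOfLinearEquiv {X Y : FinSpace.{v}} {E F : X ⟶ Y}
    (φ : ∀ y x, HilbBundle.fiber E y x ≃ₗ[ℂ] HilbBundle.fiber F y x) : E ≅ F where
  hom := ⟨fun y x => (φ y x).toLinearMap⟩
  inv := ⟨fun y x => (φ y x).symm.toLinearMap⟩
  hom_inv_id := HilbBundle.hom_ext fun y x => LinearMap.ext (φ y x).symm_apply_apply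
  inv_hom_id := HilbBundle.hom_ext fun y x => LinearMap.ext (φ y x).apply_symm_apply

/-- An invertible 2-morphism need not be isometric, so the inner products on the fibres of E play no
role and equality of dimensions suffices. -/
theorem exists_bundle_iso (E : H.space ⟶ K.space) :
    ∃ F : H ⟶ K, Nonempty (bundle F ≅ E) :=
  ⟨ofMultiplicities fun μ i => Module.finrank ℂ (HilbBundle.fiber E μ i),
    ⟨HilbBundle.isoOfLinearEquiv fun μ i =>
      LinearEquiv.ofFinrankEq _ _ (finrank_ofMultiplicities _ μ i)⟩⟩

theorem isEquivalence_mapFunctor (H K : MarkedTwoHilb.{v, u}) :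
    (bracketPseudo.mapFunctor H K).IsEquivalence where
  faithful := ⟨fun {F G} _ _ h => (bundleMapEquiv F G).injective h⟩
  full := ⟨fun {F G} => (bundleMapEquiv F G).surjective⟩
  essSurj := ⟨exists_bundle_iso⟩

end MarkedTwoHilb

/-! ### The 2-Hilbert space of matrix families over a finite space -/

/-- An idempotent matrix splits through the space whose dimension is that of its range. -/
theorem Matrix.exists_split_of_idempotent {n r : ℕ} (A : Matrix (Fin n) (Fin n) ℂ) (hA : A * A = A)
    (hr : r = Module.finrank ℂ (LinearMap.range A.toLin')) :
    ∃ (I : Matrix (Fin r) (Fin n) ℂ) (R : Matrix (Fin n) (Fin r) ℂ), I * R = 1 ∧ R * I = A := by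
  let f := A.toLin'
  have hf : f ∘ₗ f = f := by rw [← Matrix.toLin'_mul, hA]
  let φ : LinearMap.range f ≃ₗ[ℂ] (Fin r → ℂ) :=
    LinearEquiv.ofFinrankEq _ _ (by rw [Module.finrank_fin_fun]; exact hr.symm)
  refine ⟨LinearMap.toMatrix' (φ.toLinearMap ∘ₗ f.rangeRestrict),
    LinearMap.toMatrix' ((LinearMap.range f).subtype ∘ₗ φ.symm.toLinearMap), ?_, ?_⟩
  · rw [← LinearMap.toMatrix'_comp, ← LinearMap.toMatrix'_id]
    congr 1
    refine LinearMap.ext fun v => ?_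
    obtain ⟨w, hw⟩ := (φ.symm v).2
    -- An idempotent acts as the identity on its range.
    have h : f.rangeRestrict (φ.symm v) = φ.symm v := Subtype.ext (by
      rw [LinearMap.codRestrict_apply, ← hw]
      exact LinearMap.congr_fun hf w)
    simp [h]
  · rw [← LinearMap.toMatrix'_comp, ← LinearMap.toMatrix'_toLin' A]
    congr 1
    refine LinearMap.ext fun v => ?_
    simp [f]

/-- The objects of the 2-Hilbert space of a finite space: families of dimensions. -/
def MultiFamily (X : FinSpace.{v}) : Type u := ULift.{u} (Fin (Fintype.card X) → ℕ)

namespace MultiFamily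

variable {X : FinSpace.{v}}

/-- The dimension of a family at a point. -/
def dim (a : MultiFamily.{v, u} X) (x : X) : ℕ := a.down (Fintype.equivFin X x)

/-- The object with given dimensions. -/
def ofDim (d : X → ℕ) : MultiFamily.{v, u} X := ⟨fun k => d ((Fintype.equivFin X).symm k)⟩

@[simp]
theorem dim_ofDim (d : X → ℕ) (x : X) : (ofDim.{v, u} d).dim x = d x := by
  simp [dim, ofDim]

theorem ext {a b : MultiFamily.{v, u} X} (h : ∀ x, a.dim x = b.dim x) : a = b :=
  ULift.ext _ _ (funext fun k => by simpa [dim] using h ((Fintype.equivFin X).symm k))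

/-- Morphisms: families of matrices. -/
abbrev MatrixFamily (a b : MultiFamily.{v, u} X) : Type v :=
  WSum X.k (fun x => EuclideanSpace ℂ (Fin (a.dim x) × Fin (b.dim x)))

/-- The matrices of a morphism. -/
def mat {a b : MultiFamily.{v, u} X} :
    MatrixFamily a b ≃ₗ[ℂ] (∀ x, Matrix (Fin (a.dim x)) (Fin (b.dim x)) ℂ) where
  toFun f x := Matrix.of fun p q => WSum.eval x f (p, q)
  invFun A := fun x => WithLp.toLp 2 fun s => A x s.1 s.2
  map_add' _ _ := rfl
  map_smul' _ _ := rfl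
  left_inv _ := rfl
  right_inv _ := rfl

/-- In trace form the adjunction axioms reduce to rules for conjugate transposes and cyclicity of
the trace. -/
theorem inner_eq_sum_trace {a b : MultiFamily.{v, u} X} (f g : MatrixFamily a b) :
    inner ℂ f g = ∑ x, ((X.k x : ℝ) : ℂ) * ((mat f x).conjTranspose * mat g x).trace := by
  rw [WSum.inner_eq_sum_eval]
  refine Finset.sum_congr rfl fun x _ => ?_
  rw [PiLp.inner_apply, Fintype.sum_prod_type, Finset.sum_comm]
  congr 1
  refine Finset.sum_congr rfl fun q _ => Finset.sum_congr rfl fun p _ => ?_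
  exact mul_comm _ _

instance : Category.{v} (MultiFamily.{v, u} X) where
  Hom a b := MatrixFamily a b
  id a := mat.symm fun x => 1
  comp f g := mat.symm fun x => mat f x * mat g x
  id_comp f := mat.injective (funext fun x => by simp)
  comp_id f := mat.injective (funext fun x => by simp)
  assoc f g h := mat.injective (funext fun x => by simp [Matrix.mul_assoc])

theorem mat_comp {a b c : MultiFamily.{v, u} X} (f : a ⟶ b) (g : b ⟶ c) (x : X) :
    mat (f ≫ g) x = mat f x * mat g x := rfl

theorem mat_id (a : MultiFamily.{v, u} X) (x : X) : mat (𝟙 a) x = 1 := rfl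

theorem hom_ext {a b : MultiFamily.{v, u} X} {f g : a ⟶ b} (h : ∀ x, mat f x = mat g x) : f = g :=
  mat.injective (funext h)

instance : HStarCategory (MultiFamily.{v, u} X) where
  normedAddCommGroup a b := inferInstanceAs (NormedAddCommGroup (MatrixFamily a b))
  innerProductSpace a b := inferInstanceAs (InnerProductSpace ℂ (MatrixFamily a b))
  finiteDimensional a b := inferInstanceAs (FiniteDimensional ℂ (MatrixFamily a b))
  add_comp g g' f := hom_ext fun x => Matrix.add_mul (mat g x) (mat g' x) (mat f x)
  comp_add g f f' := hom_ext fun x => Matrix.mul_add (mat g x) (mat f x) (mat f' x)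
  smul_comp c g f := hom_ext fun x => Matrix.smul_mul c (mat g x) (mat f x)
  comp_smul g c f := hom_ext fun x => Matrix.mul_smul (mat g x) c (mat f x)
  dag f := mat.symm fun x => (mat f x).conjTranspose
  dag_add f g := hom_ext fun x => Matrix.conjTranspose_add (mat f x) (mat g x)
  dag_smul c f := hom_ext fun x => Matrix.conjTranspose_smul c (mat f x)
  dag_dag f := hom_ext fun x => Matrix.conjTranspose_conjTranspose (mat f x)
  dag_comp g f := hom_ext fun x => Matrix.conjTranspose_mul (mat g x) (mat f x)
  inner_comp_left g f h := by
    refine (inner_eq_sum_trace _ _).trans (Eq.trans ?_ (inner_eq_sum_trace _ _).symm)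
    refine Finset.sum_congr rfl fun x _ => congrArg _ ?_
    change ((mat g x * mat f x).conjTranspose * mat h x).trace =
      ((mat g x).conjTranspose * (mat h x * (mat f x).conjTranspose)).trace
    rw [Matrix.conjTranspose_mul, Matrix.mul_assoc, Matrix.trace_mul_comm, Matrix.mul_assoc]
  inner_comp_right g f h := by
    refine (inner_eq_sum_trace _ _).trans (Eq.trans ?_ (inner_eq_sum_trace _ _).symm)
    refine Finset.sum_congr rfl fun x _ => congrArg _ ?_
    change ((mat g x * mat f x).conjTranspose * mat h x).trace =
      ((mat f x).conjTranspose * ((mat g x).conjTranspose * mat h x)).trace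
    rw [Matrix.conjTranspose_mul, Matrix.mul_assoc]

theorem finrank_hom (a b : MultiFamily.{v, u} X) :
    Module.finrank ℂ (a ⟶ b) = ∑ x, a.dim x * b.dim x := by
  refine (LinearEquiv.finrank_eq (mat (a := a) (b := b))).trans ?_
  simp [Module.finrank_pi_fintype, Module.finrank_matrix]

theorem mat_zero {a b : MultiFamily.{v, u} X} (x : X) : mat (0 : a ⟶ b) x = 0 := rfl

theorem mat_sum {a b : MultiFamily.{v, u} X} {J : Type*} (s : Finset J) (f : J → (a ⟶ b)) (x : X) :
    mat (∑ j ∈ s, f j) x = ∑ j ∈ s, mat (f j) x := by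
  refine (congrFun (map_sum mat f s) x).trans ?_
  rw [Finset.sum_apply]

instance hasBiproduct {J : Type} [Fintype J] (F : J → MultiFamily.{v, u} X) : HasBiproduct F := by
  classical
  let N : MultiFamily.{v, u} X := ofDim fun x => ∑ j, (F j).dim x
  -- The inclusions and projections of the biproduct are blocks of the identity matrix, cut out by
  -- this bijection.
  let eqv (x : X) : (Σ j, Fin ((F j).dim x)) ≃ Fin (N.dim x) :=
    Fintype.equivOfCardEq (by simp [N])
  let b : Bicone F :=
    { pt := N
      ι := fun j => mat.symm fun x => (1 : Matrix (Fin (N.dim x)) (Fin (N.dim x)) ℂ).submatrix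
        (fun p => eqv x ⟨j, p⟩) id
      π := fun j => mat.symm fun x => (1 : Matrix (Fin (N.dim x)) (Fin (N.dim x)) ℂ).submatrix
        id (fun p => eqv x ⟨j, p⟩)
      ι_π := fun j j' => by
        split_ifs with h
        · subst h
          refine hom_ext fun x => Matrix.ext fun p q => ?_
          simp [mat_comp, mat_id, Matrix.mul_apply, Matrix.one_apply]
        · refine hom_ext fun x => Matrix.ext fun p q => ?_
          simp [mat_comp, mat_zero, Matrix.mul_apply, Matrix.one_apply, h] }
  refine hasBiproduct_of_total b (hom_ext fun x => ?_)
  refine (mat_sum Finset.univ (fun j => b.π j ≫ b.ι j) x).trans ?_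
  refine Matrix.ext fun s t => ?_
  obtain ⟨s, rfl⟩ := (eqv x).surjective s
  obtain ⟨t, rfl⟩ := (eqv x).surjective t
  rw [Matrix.sum_apply]
  simp only [mat_comp, mat_id, b, LinearEquiv.apply_symm_apply, Matrix.mul_apply,
    Matrix.submatrix_apply, Matrix.one_apply, id, (eqv x).injective.eq_iff]
  rw [← Fintype.sum_sigma' (fun j p => (if s = ⟨j, p⟩ then (1 : ℂ) else 0) *
    (if ⟨j, p⟩ = t then (1 : ℂ) else 0))]
  simp

instance : IsTwoHilbert (MultiFamily.{v, u} X) where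
  hasFiniteBiproducts := ⟨fun n => ⟨fun F => hasBiproduct F⟩⟩
  isIdempotentComplete := ⟨fun a p hp => by
    let b : MultiFamily.{v, u} X := ofDim fun x =>
      Module.finrank ℂ (LinearMap.range (mat p x).toLin')
    -- Dimensions are stored through an enumeration of X, so the dimension of b at x equals the rank
    -- only up to a proof; hence the separate `r` with its equation.
    have h (x : X) := Matrix.exists_split_of_idempotent (r := b.dim x) (mat p x)
      (congrFun (congrArg mat hp) x) (dim_ofDim _ x)
    choose I R hIR hRI using h
    exact ⟨b, mat.symm I, mat.symm R, hom_ext hIR, hom_ext hRI⟩⟩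

open Classical in
/-- The simple object supported at a point. -/
def point (x : X) : MultiFamily.{v, u} X := ofDim (Pi.single x 1)

open Classical in
theorem dim_point (x y : X) : (point.{v, u} x).dim y = if y = x then 1 else 0 := by
  rw [point, dim_ofDim, Pi.single_apply]

theorem isSimpleObject_point (x : X) : IsSimpleObject (point.{v, u} x) := by
  classical
  rw [IsSimpleObject, finrank_hom]
  simp [dim_point]

/-- The endomorphism algebra of a has dimension ∑ (a.dim x)², which is 1 only when a is a unit
vector, that is, a point. -/
theorem existsUnique_iso_point (a : MultiFamily.{v, u} X) (ha : IsSimpleObject a) :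
    ∃! x, Nonempty (a ≅ point x) := by
  classical
  rw [IsSimpleObject, finrank_hom] at ha
  have h1 (x y : X) (hx : a.dim x ≠ 0) (hy : y ≠ x) : a.dim y = 0 := by
    by_contra h0
    have h2 : ∑ z ∈ {x, y}, a.dim z * a.dim z ≤ ∑ z, a.dim z * a.dim z :=
      Finset.sum_le_sum_of_subset (Finset.subset_univ _)
    rw [Finset.sum_pair hy.symm, ha] at h2
    have := Nat.mul_pos (Nat.pos_of_ne_zero hx) (Nat.pos_of_ne_zero hx)
    have := Nat.mul_pos (Nat.pos_of_ne_zero h0) (Nat.pos_of_ne_zero h0)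
    omega
  -- The space of maps from a to the point y has dimension `a.dim y`, so it could not contain an
  -- isomorphism if this vanished.
  have h3 (y : X) (φ : a ≅ point y) : a.dim y ≠ 0 := fun h0 => by
    have hz : Module.finrank ℂ (a ⟶ point y) = 0 := by
      rw [finrank_hom]
      simp [dim_point, h0]
    have hs := Module.finrank_zero_iff.1 hz
    have hid : 𝟙 (point y) = 0 := by
      rw [← φ.inv_hom_id, Subsingleton.elim φ.hom 0, comp_zero]
    have hs' : Subsingleton (point y ⟶ point y) :=
      ⟨fun f g => by rw [← Category.comp_id f, ← Category.comp_id g, hid, comp_zero, comp_zero]⟩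
    have := isSimpleObject_point y
    rw [IsSimpleObject, Module.finrank_zero_iff.2 hs'] at this
    exact zero_ne_one this
  obtain ⟨x, hx⟩ : ∃ x, a.dim x ≠ 0 := by
    by_contra! h0
    simp [h0] at ha
  have hax : a = point x := ext fun y => by
    rw [dim_point]
    split_ifs with h
    · subst h
      rw [Finset.sum_eq_single y (fun z _ hz => by rw [h1 y z hx hz, mul_zero]) (by simp)] at ha
      exact Nat.eq_one_of_mul_eq_one_left ha
    · exact h1 x y hx h
  refine ⟨x, ⟨eqToIso hax⟩, fun y ⟨φ⟩ => ?_⟩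
  by_contra hy
  exact h3 y φ (h1 x y hx hy)

theorem re_inner_id_point (x : X) :
    RCLike.re (inner ℂ (𝟙 (point.{v, u} x)) (𝟙 (point x))) = (X.k x : ℝ) := by
  classical
  have h := inner_eq_sum_trace (𝟙 (point.{v, u} x)) (𝟙 (point x))
  simp only [mat_id, Matrix.conjTranspose_one, Matrix.mul_one, Matrix.trace_one, Fintype.card_fin,
    dim_point] at h
  refine (congrArg RCLike.re h).trans ?_
  simp

end MultiFamily

/-- The marked 2-Hilbert space of a finite space. -/
def FinSpace.toTwoHilb (X : FinSpace.{v}) : MarkedTwoHilb.{v, u} where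
  carrier := MultiFamily.{v, u} X
  ι := X
  e := MultiFamily.point
  isSimple := MultiFamily.isSimpleObject_point
  existsUnique_iso := MultiFamily.existsUnique_iso_point

/-- The identity of the point x is a 1 × 1 matrix at x and empty elsewhere, so its squared norm is
k_x. The original space is recovered on the nose, and the identity equivalence gives essential
surjectivity. -/
theorem FinSpace.space_toTwoHilb (X : FinSpace.{v}) : X.toTwoHilb.{v, u}.space = X := by
  have h : X.toTwoHilb.{v, u}.scale = X.k :=
    funext fun x => Subtype.ext (MultiFamily.re_inner_id_point x)
  change ({ carrier := X, k := X.toTwoHilb.{v, u}.scale } : FinSpace) = X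
  rw [h]

theorem isTwoEquivalence_bracketPseudo :
    IsTwoEquivalence MarkedTwoHilb.bracketPseudo.{v, u} :=
  ⟨MarkedTwoHilb.isEquivalence_mapFunctor, fun X => ⟨X.toTwoHilb, by
    change Nonempty (X.toTwoHilb.space ≌ X)
    rw [X.space_toTwoHilb]
    exact ⟨Bicategory.Equivalence.id X⟩⟩⟩

theorem mainTheorem9 :
    ∃ Φ : Pseudofunctor MarkedTwoHilb.{v, u} FinSpace.{v},
      -- it is the assignment described above, with the stated coherence 2-cells
      Φ.toLax = MarkedTwoHilb.bracket.{v, u} ∧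
      -- the coherence 2-cells are unitary
      (∀ H : MarkedTwoHilb.{v, u}, IsUnitaryCell (Φ.mapId H).inv) ∧
      (∀ {H K L : MarkedTwoHilb.{v, u}} (F : H ⟶ K) (G : K ⟶ L),
        IsUnitaryCell (Φ.mapComp F G).inv) ∧
      -- it is an equivalence of 2-categories
      IsTwoEquivalence Φ ∧
      -- it is a unitary linear map on 2-morphisms
      ∀ {H K : MarkedTwoHilb.{v, u}} (F G : H ⟶ K),
        ∃ U : (F ⟶ G) ≃ₗ[ℂ] (Φ.map F ⟶ Φ.map G),
          (∀ θ : F ⟶ G, U θ = Φ.map₂ θ) ∧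
          ∀ θ θ' : F ⟶ G, bundleInner (U θ) (U θ') = natInner θ θ' :=
  ⟨MarkedTwoHilb.bracketPseudo, MarkedTwoHilb.bracketPseudo_toLax,
    MarkedTwoHilb.isUnitaryCell_unitor, MarkedTwoHilb.isUnitaryCell_compositor,
    isTwoEquivalence_bracketPseudo, fun F G => ⟨MarkedTwoHilb.bundleMapEquiv F G, fun _ => rfl,
      MarkedTwoHilb.bundleInner_bundleMap⟩⟩

end
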